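/- Let $G$ be a finite simple graph. Call a graph a \emph{cactus} if each of its edges lies in at most one cycle, and \emph{chordal} if it has no induced cycle of length at least $4$. The graph $G$ is \emph{co-chordal-cactus} if there are a finite cactus graph $T$ (the skeleton) and, for each edge $e$ of $T$, an induced subgraph $H_e$ of the complement $\overline G$ such that: \begin{enumerate} \item each $H_e$ is a cycle of length at least $3$ or a chordal graph; \item $V(\overline G)=\bigcup_{e\in E(T)}V(H_e)$ and $E(\overline G)=\bigcup_{e\in E(T)}E(H_e)$; \item for distinct $e,f\in E(T)$ one has $|V(H_e)\cap V(H_f)|\le 1$, and the intersection is nonempty only if $e$ and $f$ share an endpoint in $T$; \item the gluing follows the skeleton: if $k\ge 3$, $e_1,\dots,e_k\in E(T)$ are distinct and $x_1,\dots,x_k\in V(\overline G)$ are distinct vertices with $x_i\in V(H_{e_i})\cap V(H_{e_{i+1}})$ for all $i$ (indices modulo $k$), then $e_1,\dots,e_k$ lie on one cycle of $T$. \end{enumerate} Let $\mathbb K$ be a field, let $R=\mathbb K[x_v : v\in V(G)]$ with the standard grading, and let $I_1(G)=(x_ux_v : \{u,v\}\in E(G))\subseteq R$ be the edge ideal of $G$.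 For a homogeneous ideal $I\subseteq R$ with graded Betti numbers $\beta_{i,j}(I)$ (the number of summands $R(-j)$ in the $i$-th module of the minimal graded free resolution of $I$), the Castelnuovo--Mumford regularity is $\operatorname{reg}(I)=\max\{j-i : \beta_{i,j}(I)\ne 0\}$, with $\operatorname{reg}(0)=-\infty$. \textbf{Theorem.} If $G$ is a co-chordal-cactus graph, then $\operatorname{reg}(I_1(G))\le 3$. -/

import Mathlib

open MvPolynomial

/-! ### Connected ideals -/

/-- The `r`-connected ideal `I_r(G)` in `K[x_v : v ∈ V]`, generated by the squarefree monomials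
`∏_{v ∈ S} x_v`, where `S` has `r + 1` elements and `G[S]` is connected. -/
noncomputable def connectedIdeal (K : Type*) [Field K] {V : Type*} (G : SimpleGraph V) (r : ℕ) :
    Ideal (MvPolynomial V K) :=
  Ideal.span {m | ∃ S : Finset V, S.card = r + 1 ∧ (G.induce (S : Set V)).Connected ∧
    m = ∏ v ∈ S, X v}

/-! ### Minimal graded free resolutions and regularity -/

/-- A minimal graded free resolution `⋯ → F_1 → F_0 → I → 0` of an ideal `I` of the standard
graded ring `R = K[x_v : v ∈ V]`, where `F_i` is the free module of rank `rank i` whose basis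
elements have the degrees `deg i`, that is, `F_i = ⨁ₐ R(-deg i a)`. -/
structure MinimalGradedFreeResolution {K V : Type*} [Field K] (I : Ideal (MvPolynomial V K)) where
  /-- the rank of `F_i` -/
  rank : ℕ → ℕ
  /-- the degrees of the basis elements of `F_i` -/
  deg : (i : ℕ) → Fin (rank i) → ℕ
  /-- the augmentation `F_0 → R`, with image `I` -/
  aug : (Fin (rank 0) → MvPolynomial V K) →ₗ[MvPolynomial V K] MvPolynomial V K
  /-- the differential `F_{i+1} → F_i` -/
  d : (i : ℕ) → (Fin (rank (i + 1)) → MvPolynomial V K) →ₗ[MvPolynomial V K]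
    (Fin (rank i) → MvPolynomial V K)
  /-- the augmentation preserves degrees -/
  aug_homogeneous : ∀ a, (aug (Pi.single a 1)).IsHomogeneous (deg 0 a)
  /-- the differentials preserve degrees: every matrix entry is `0` or homogeneous of the
  degree by which the degrees of the two basis elements differ -/
  d_homogeneous : ∀ i b a, d i (Pi.single b 1) a = 0 ∨
    ∃ k, deg i a + k = deg (i + 1) b ∧ (d i (Pi.single b 1) a).IsHomogeneous k
  range_aug : LinearMap.range aug = I
  exact_zero : Function.Exact (d 0) aug
  exact_succ : ∀ i, Function.Exact (d (i + 1)) (d i)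
  /-- the matrix entries of the differentials lie in the ideal generated by the variables -/
  minimal : ∀ i b a, constantCoeff (d i (Pi.single b 1) a) = 0

/-- The graded Betti number `β_{i,j}` read off from a minimal graded free resolution: the number
of summands `R(-j)` of `F_i`. -/
noncomputable def MinimalGradedFreeResolution.betti {K V : Type*} [Field K]
    {I : Ideal (MvPolynomial V K)} (F : MinimalGradedFreeResolution I) (i j : ℕ) : ℕ :=
  Nat.card {a : Fin (F.rank i) // F.deg i a = j}

/-- The Castelnuovo–Mumford regularity `reg I = max {j - i | β_{i,j}(I) ≠ 0}`, read off from a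
minimal graded free resolution. Such a resolution is unique up to isomorphism, so the infimum
is over a single value; it would be `⊤` if there were no resolution. `reg 0 = ⊥`. -/
noncomputable def castelnuovoMumfordRegularity {K V : Type*} [Field K]
    (I : Ideal (MvPolynomial V K)) : EReal :=
  ⨅ F : MinimalGradedFreeResolution I,
    ⨆ (i : ℕ) (j : ℕ) (_ : F.betti i j ≠ 0), (((j : ℝ) - (i : ℝ) : ℝ) : EReal)

/-! ### Co-chordal-cactus graphs -/

/-- Every induced cycle of length at least four has a chord, that is, there is no chordless
cycle of length at least four. -/
def IsChordalGraph {V : Type*} (H : SimpleGraph V) : Prop :=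
  ∀ n : ℕ, 4 ≤ n → ¬ (SimpleGraph.cycleGraph n).IsIndContained H

/-- `H` is a cycle of length at least three. -/
def IsCycleGraph {V : Type*} (H : SimpleGraph V) : Prop :=
  ∃ n : ℕ, 3 ≤ n ∧ Nonempty (SimpleGraph.cycleGraph n ≃g H)

/-- A cactus graph: every edge lies in at most one cycle (cycles being subgraphs, that is,
two closed walks which run through the same edges are the same cycle). -/
def IsCactusGraph {W : Type*} (T : SimpleGraph W) : Prop :=
  ∀ (u v : W) (p : T.Walk u u) (q : T.Walk v v), p.IsCycle → q.IsCycle →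
    ∀ e, e ∈ p.edges → e ∈ q.edges → ∀ f, f ∈ p.edges ↔ f ∈ q.edges

/-- `H` is obtained by gluing cycles and chordal graphs along the cactus skeleton `T`; the piece
that belongs to the edge `e` of `T` is the induced subgraph `H[S e]`. -/
structure IsChordalCactusDecomposition {V W : Type*} (H : SimpleGraph V) (T : SimpleGraph W)
    (S : T.edgeSet → Set V) : Prop where
  cactus : IsCactusGraph T
  cycle_or_chordal : ∀ e, IsCycleGraph (H.induce (S e)) ∨ IsChordalGraph (H.induce (S e))
  cover_vertices : ∀ v, ∃ e, v ∈ S e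
  cover_edges : ∀ u v, H.Adj u v → ∃ e, u ∈ S e ∧ v ∈ S e
  /-- distinct pieces share at most one vertex -/
  inter_subsingleton : ∀ e f, e ≠ f → (S e ∩ S f).Subsingleton
  /-- distinct pieces meet only if their edges share an endpoint in `T` -/
  common_endpoint : ∀ e f, e ≠ f → (S e ∩ S f).Nonempty → ∃ w : W, w ∈ e.1 ∧ w ∈ f.1
  /-- the gluing follows the skeleton: pieces that are glued to one another cyclically, at
  distinct vertices, belong to edges of one and the same cycle of `T`
  (indices in `Fin (n + 3)`, where `i + 1` is taken modulo `n + 3`) -/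
  gluing_cycle : ∀ (n : ℕ) (e : Fin (n + 3) → T.edgeSet) (x : Fin (n + 3) → V),
    Function.Injective e → Function.Injective x → (∀ i, x i ∈ S (e i) ∩ S (e (i + 1))) →
    ∃ (w : W) (p : T.Walk w w), p.IsCycle ∧ ∀ i, (e i).1 ∈ p.edges

/-- `G` is a co-chordal-cactus graph: its complement is obtained by gluing cycles and chordal
graphs along a finite cactus skeleton. -/
def IsCoChordalCactus {V : Type*} (G : SimpleGraph V) : Prop :=
  ∃ (m : ℕ) (T : SimpleGraph (Fin m)) (S : T.edgeSet → Set V),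
    IsChordalCactusDecomposition Gᶜ T S

/-! Put `H = Gᶜ`. The edge ideal of `G` is the Stanley–Reisner ideal of the clique complex of `H`.
Regularity of its quotient is measured by Koszul homology with respect to the variables. A chain may
mix all exterior degrees, because the bound concerns only the degree of its coefficients.

Splitting off a vertex `x` bounds the regularity of a complex by the larger of that of the deletion
and one more than that of the link. In a clique complex the link is the clique complex of the
neighbourhood. A chordal graph has a simplicial vertex (Dirac), whose link is a simplex, so chordal
graphs give regularity at most 1. Graphs with chordal neighbourhoods therefore give at most 2, and
passing from the quotient to the ideal gives 3. A resolution realizing the bound is built from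
iterated syzygies, each step raising the regularity by at most one.

It remains to see that the neighbourhood of `x` in `H` contains no induced cycle of length at least
4 (`exists_piece_of_cycle`, `chordalOn_neighborSet`). Assign to each vertex of such a rim the piece
containing its edge to `x`. Where this piece changes, a triangle at `x` is spread over three pieces.
By the gluing condition and the cactus property their edges form a triangle of the skeleton,
determined by any one of them, and pieces share at most one vertex. So a piece at `x` belongs to at
most one such triangle, while a rim with changes would need two. Hence the whole wheel lies in one
piece, impossible in a cycle and in a chordal graph alike. -/

/-! ### The Koszul complex of the variables -/

section Koszul

variable {V : Type*} [LinearOrder V]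

/-- The sign of the position of `v` relative to the elements of `T`. -/
def koszulSign (v : V) (T : Finset V) : ℤ := (-1) ^ (T.filter (· < v)).card

theorem koszulSign_mul_self (v : V) (T : Finset V) : koszulSign v T * koszulSign v T = 1 := by
  simp [koszulSign, ← mul_pow]

theorem koszulSign_insert_of_lt {v w : V} (h : w < v) {T : Finset V} (hw : w ∉ T) :
    koszulSign v (insert w T) = -koszulSign v T := by
  simp [koszulSign, Finset.filter_insert, h, hw, pow_succ]

theorem koszulSign_insert_of_le {v w : V} (h : v ≤ w) (T : Finset V) :
    koszulSign v (insert w T) = koszulSign v T := by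
  simp [koszulSign, Finset.filter_insert, not_lt.mpr h]

/-- Exterior generators anticommute: only the sign of the larger vertex notices the insertion of the
other. -/
theorem koszulSign_mul_insert {v w : V} (h : v ≠ w) {T : Finset V} (hv : v ∉ T) (hw : w ∉ T) :
    koszulSign v T * koszulSign w (insert v T) = -(koszulSign w T * koszulSign v (insert w T)) := by
  rcases lt_or_gt_of_ne h with h | h
  · rw [koszulSign_insert_of_lt h hv, koszulSign_insert_of_le h.le]; ring
  · rw [koszulSign_insert_of_lt h hw, koszulSign_insert_of_le h.le]; ring

variable {R M : Type*} [CommRing R] [AddCommGroup M] [Module R M]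

/-- Contraction by the `v`-th basis covector on chains with coefficients in `M`; a chain
assigns to `T` the coefficient of the exterior monomial `e_T`. -/
def koszulContract (v : V) : (Finset V → M) →ₗ[R] (Finset V → M) where
  toFun f T := if v ∈ T then 0 else koszulSign v T • f (insert v T)
  map_add' f g := by ext T; by_cases h : v ∈ T <;> simp [h]
  map_smul' c f := by ext T; by_cases h : v ∈ T <;> simp [h, smul_comm c]

/-- Left multiplication by the exterior generator `e_v`. -/
def koszulWedge (v : V) : (Finset V → M) →ₗ[R] (Finset V → M) where
  toFun f T := if v ∈ T then koszulSign v (T.erase v) • f (T.erase v) else 0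
  map_add' f g := by ext T; by_cases h : v ∈ T <;> simp [h]
  map_smul' c f := by ext T; by_cases h : v ∈ T <;> simp [h, smul_comm c]

theorem koszulContract_apply (v : V) (f : Finset V → M) (T : Finset V) :
    koszulContract (R := R) v f T = if v ∈ T then 0 else koszulSign v T • f (insert v T) := rfl

theorem koszulWedge_apply (v : V) (f : Finset V → M) (T : Finset V) :
    koszulWedge (R := R) v f T =
      if v ∈ T then koszulSign v (T.erase v) • f (T.erase v) else 0 := rfl

theorem koszulContract_self (v : V) (f : Finset V → M) :
    koszulContract (R := R) v (koszulContract (R := R) v f) = 0 := by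
  ext T
  by_cases h : v ∈ T <;> simp [koszulContract_apply, h]

theorem koszulContract_comm {v w : V} (h : v ≠ w) (f : Finset V → M) :
    koszulContract (R := R) v (koszulContract (R := R) w f) =
      -koszulContract (R := R) w (koszulContract (R := R) v f) := by
  ext T
  by_cases hv : v ∈ T
  · simp [koszulContract_apply, hv]
  by_cases hw : w ∈ T
  · simp [koszulContract_apply, hw]
  simp only [koszulContract_apply, hv, hw, if_false, Finset.mem_insert, h, h.symm, or_self,
    Pi.neg_apply, smul_smul]
  rw [koszulSign_mul_insert h hv hw, Finset.insert_comm, neg_smul]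

theorem koszulContract_wedge_self (v : V) (f : Finset V → M) :
    koszulContract (R := R) v (koszulWedge (R := R) v f) +
      koszulWedge (R := R) v (koszulContract (R := R) v f) = f := by
  ext T
  by_cases h : v ∈ T
  · simp [koszulContract_apply, koszulWedge_apply, h, smul_smul, koszulSign_mul_self]
  · simp [koszulContract_apply, koszulWedge_apply, h, smul_smul, koszulSign_mul_self]

theorem koszulContract_wedge {v w : V} (h : v ≠ w) (f : Finset V → M) :
    koszulContract (R := R) w (koszulWedge (R := R) v f) =
      -koszulWedge (R := R) v (koszulContract (R := R) w f) := by
  ext T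
  by_cases hv : v ∈ T
  · obtain ⟨T, hvT, rfl⟩ : ∃ T', v ∉ T' ∧ T = insert v T' :=
      ⟨T.erase v, by simp, by simp [hv]⟩
    by_cases hw : w ∈ T
    · simp [koszulContract_apply, koszulWedge_apply, hw, hvT]
    · have e : (insert w (insert v T)).erase v = insert w T := by
        rw [Finset.insert_comm, Finset.erase_insert (by simp [hvT, h])]
      simp only [koszulContract_apply, koszulWedge_apply, hw, hvT, e, h.symm, Finset.mem_insert,
        or_self, if_false, true_or, or_true, if_true, Pi.neg_apply, smul_smul,
        Finset.erase_insert hvT]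
      have := koszulSign_mul_insert h hvT hw
      have h1 := koszulSign_mul_self v T
      have h2 := koszulSign_mul_self v (insert w T)
      rw [← neg_smul]
      congr 1
      -- Signs square to one, so multiplying `this` by both signs at `v` moves each of them across
      -- the equation.
      linear_combination (koszulSign v T * koszulSign v (insert w T)) * this -
        (koszulSign w (insert v T) * koszulSign v (insert w T)) * h1 -
        (koszulSign w T * koszulSign v T) * h2
  · by_cases hw : w ∈ T <;> simp [koszulContract_apply, koszulWedge_apply, hw, hv, h]

variable {K : Type*} [Field K] {N : Type*} [AddCommGroup N] [Module (MvPolynomial V K) N]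

theorem koszulWedge_mem (P : Submodule (MvPolynomial V K) N) (v : V) {f : Finset V → N}
    (hf : ∀ T, f T ∈ P) (T : Finset V) : koszulWedge (R := MvPolynomial V K) v f T ∈ P := by
  rw [koszulWedge_apply]
  split_ifs
  · exact zsmul_mem (hf _) _
  · exact P.zero_mem

theorem koszulWedge_isHomogeneous (v : V) {d : ℕ} {f : Finset V → MvPolynomial V K}
    (hf : ∀ T, (f T).IsHomogeneous d) (T : Finset V) :
    (koszulWedge (R := MvPolynomial V K) v f T).IsHomogeneous d := by
  rw [koszulWedge_apply]
  split_ifs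
  · exact zsmul_mem (K := homogeneousSubmodule V K d) (hf _) _
  · exact isHomogeneous_zero _ _ _

variable [Fintype V]

/-- The differential of the Koszul complex of the variables with coefficients in `N`. -/
noncomputable def koszulD : (Finset V → N) →ₗ[MvPolynomial V K] (Finset V → N) :=
  ∑ v, (X v : MvPolynomial V K) • koszulContract v

theorem koszulD_eq (f : Finset V → N) :
    koszulD (K := K) f = ∑ v, (X v : MvPolynomial V K) • koszulContract (R := MvPolynomial V K) v f := by
  simp [koszulD, LinearMap.sum_apply]

theorem koszulD_apply (f : Finset V → N) (T : Finset V) :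
    koszulD (K := K) f T =
      ∑ v, (X v : MvPolynomial V K) • koszulContract (R := MvPolynomial V K) v f T := by
  simp [koszulD_eq, Finset.sum_apply]

theorem koszulD_koszulD (f : Finset V → N) : koszulD (K := K) (koszulD (K := K) f) = 0 := by
  simp only [koszulD_eq, map_sum, map_smul, Finset.smul_sum, smul_smul]
  rw [← Finset.sum_product']
  refine Finset.sum_involution (fun p _ => (p.2, p.1)) ?_ ?_ ?_ ?_
  · rintro ⟨v, w⟩ -
    by_cases h : v = w
    · subst h; simp [koszulContract_self]
    · simp only
      rw [koszulContract_comm h, mul_comm, smul_neg]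
      exact add_neg_cancel _
  · rintro ⟨v, w⟩ - h1 h2
    simp only [Prod.mk.injEq] at h2
    obtain rfl := h2.1
    simp [koszulContract_self] at h1
  · simp
  · simp

/-- The wedge with `e_v` is a homotopy making multiplication by `x_v` null-homotopic; this is what
makes cones harmless. -/
theorem koszulD_wedge (v : V) (f : Finset V → N) :
    koszulD (K := K) (koszulWedge (R := MvPolynomial V K) v f) +
      koszulWedge (R := MvPolynomial V K) v (koszulD (K := K) f) = (X v : MvPolynomial V K) • f := by
  simp only [koszulD_eq, map_sum, map_smul]
  rw [← Finset.sum_add_distrib, Finset.sum_eq_single v]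
  · rw [← smul_add, koszulContract_wedge_self]
  · intro w _ h
    rw [koszulContract_wedge h.symm, smul_neg, neg_add_cancel]
  · simp

theorem koszulD_map {N' : Type*} [AddCommGroup N'] [Module (MvPolynomial V K) N']
    (φ : N →ₗ[MvPolynomial V K] N') (f : Finset V → N) (T : Finset V) :
    koszulD (K := K) (fun T => φ (f T)) T = φ (koszulD (K := K) f T) := by
  simp only [koszulD_apply, map_sum, map_smul, koszulContract_apply]
  refine Finset.sum_congr rfl fun v _ => ?_
  split_ifs <;> simp

theorem koszulD_mem (P : Submodule (MvPolynomial V K) N) {f : Finset V → N} (hf : ∀ T, f T ∈ P)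
    (T : Finset V) : koszulD (K := K) f T ∈ P := by
  rw [koszulD_apply]
  refine P.sum_mem fun v _ => P.smul_mem _ ?_
  rw [koszulContract_apply]
  split_ifs
  · exact P.zero_mem
  · exact zsmul_mem (hf _) _

end Koszul

/-! ### Stanley–Reisner ideals and regularity of quotients -/

section StanleyReisner

variable {V K : Type*} [Field K]

/-- The Stanley–Reisner ideal of the down-closed family `D`: the polynomials none of whose
monomials is supported on a member of `D`. -/
def faceIdeal (K : Type*) [Field K] (D : LowerSet (Finset V)) : Ideal (MvPolynomial V K) where
  carrier := {p | ∀ m ∈ p.support, m.support ∉ D}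
  zero_mem' := by simp
  add_mem' {p q} hp hq m hm := by
    classical
    rcases Finset.mem_union.mp (support_add hm) with h | h
    exacts [hp m h, hq m h]
  smul_mem' c p hp m hm := by
    classical
    obtain ⟨a, -, b, hb, rfl⟩ := Finset.mem_add.mp (support_mul c p hm)
    refine fun h => hp b hb (D.lower ?_ h)
    exact Finsupp.support_mono le_add_self

theorem mem_faceIdeal {D : LowerSet (Finset V)} {p : MvPolynomial V K} :
    p ∈ faceIdeal K D ↔ ∀ m ∈ p.support, m.support ∉ D := Iff.rfl

/-- The faces not containing `x`. -/
def faceDeletion (D : LowerSet (Finset V)) (x : V) : LowerSet (Finset V) where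
  carrier := {T | T ∈ D ∧ x ∉ T}
  lower' _ _ h hT := ⟨D.lower h hT.1, fun hx => hT.2 (h hx)⟩

/-- The closed star of `x`. -/
def faceStar [DecidableEq V] (D : LowerSet (Finset V)) (x : V) : LowerSet (Finset V) where
  carrier := {T | insert x T ∈ D}
  lower' _ _ h hT := D.lower (Finset.insert_subset_insert x h) hT

theorem mem_faceDeletion {D : LowerSet (Finset V)} {x : V} {T : Finset V} :
    T ∈ faceDeletion D x ↔ T ∈ D ∧ x ∉ T := Iff.rfl

theorem mem_faceStar [DecidableEq V] {D : LowerSet (Finset V)} {x : V} {T : Finset V} :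
    T ∈ faceStar D x ↔ insert x T ∈ D := Iff.rfl

/-- Multiplication by `x` adds `x` to the support of every monomial, so the colon ideal by `x`
belongs to the star. -/
theorem X_mul_mem_faceIdeal [DecidableEq V] {D : LowerSet (Finset V)} {x : V}
    {p : MvPolynomial V K} : X x * p ∈ faceIdeal K D ↔ p ∈ faceIdeal K (faceStar D x) := by
  simp only [mem_faceIdeal, support_X_mul, Finset.mem_map, forall_exists_index, and_imp,
    forall_apply_eq_imp_iff₂, mem_faceStar, addLeftEmbedding_apply]
  refine forall₂_congr fun m _ => ?_
  have : (Finsupp.single x 1 + m).support = insert x m.support := by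
    ext v
    by_cases h : x = v <;> simp [h, eq_comm]
  rw [this]

/-- Modulo the ideal of `D`, a polynomial in the ideal of the deletion of `x` is divisible
by `x`, compatibly with degrees. -/
theorem exists_eq_add_X_mul {D : LowerSet (Finset V)} {x : V} {p : MvPolynomial V K} {d : ℕ}
    (hp : p ∈ faceIdeal K (faceDeletion D x)) (hd : p.IsHomogeneous (d + 1)) :
    ∃ h : MvPolynomial V K, h.IsHomogeneous d ∧ p - X x * h ∈ faceIdeal K D := by
  classical
  -- Divide by `x`: the monomials of the remainder avoid `x`, so a face of `D` supporting one would
  -- lie in the deletion.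
  refine ⟨p.divMonomial (Finsupp.single x 1), ?_, ?_⟩
  · intro m hm
    rw [coeff_divMonomial] at hm
    have := hd hm
    rw [map_add] at this
    simp [Finsupp.weight_apply] at this ⊢
    omega
  · have h := divMonomial_add_modMonomial p (Finsupp.single x 1)
    have hX : (monomial (Finsupp.single x 1) (1 : K)) = X x := rfl
    rw [hX] at h
    rw [sub_eq_of_eq_add' h.symm]
    intro m hm hmD
    rw [mem_support_iff] at hm
    by_cases hx : Finsupp.single x 1 ≤ m
    · exact hm (coeff_modMonomial_of_le _ hx)
    · rw [coeff_modMonomial_of_not_le _ hx] at hm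
      refine hp m (mem_support_iff.mpr hm) ⟨hmD, fun hxm => hx ?_⟩
      rw [Finsupp.single_le_iff]
      exact Nat.one_le_iff_ne_zero.mpr (Finsupp.mem_support_iff.mp hxm)

variable [Fintype V] [LinearOrder V]

/-- The quotient by `I` has regularity at most `r`: its Koszul homology in homological degree
`i` vanishes in all internal degrees above `i + r`. -/
def QuotRegular (I : Ideal (MvPolynomial V K)) (r : ℕ) : Prop :=
  ∀ d, r ≤ d → ∀ f : Finset V → MvPolynomial V K, (∀ T, (f T).IsHomogeneous (d + 1)) →
    (∀ T, koszulD (K := K) f T ∈ I) →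
    ∃ g : Finset V → MvPolynomial V K, (∀ T, (g T).IsHomogeneous d) ∧
      ∀ T, f T - koszulD (K := K) g T ∈ I

theorem QuotRegular.mono {I : Ideal (MvPolynomial V K)} {r s : ℕ} (h : QuotRegular I r)
    (hrs : r ≤ s) : QuotRegular I s :=
  fun d hd => h d (hrs.trans hd)

theorem koszulD_isHomogeneous {d : ℕ} {f : Finset V → MvPolynomial V K}
    (hf : ∀ T, (f T).IsHomogeneous d) (T : Finset V) :
    (koszulD (K := K) f T).IsHomogeneous (d + 1) := by
  rw [koszulD_apply]
  refine IsHomogeneous.sum _ _ _ fun v _ => ?_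
  rw [add_comm, smul_eq_mul]
  refine (isHomogeneous_X K v).mul ?_
  rw [koszulContract_apply]
  split_ifs
  · exact isHomogeneous_zero _ _ _
  · exact zsmul_mem (K := homogeneousSubmodule V K d) (hf _) _

/-- A cycle modulo the ideal of `D` which bounds modulo the ideal of the deletion of `x` is
homologous to a multiple of `x`. -/
theorem exists_koszul_decomposition {D : LowerSet (Finset V)} {x : V} {r d : ℕ}
    (hdel : QuotRegular (faceIdeal K (faceDeletion D x)) r) (hd : r ≤ d)
    {f : Finset V → MvPolynomial V K} (hf : ∀ T, (f T).IsHomogeneous (d + 1))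
    (hfD : ∀ T, koszulD (K := K) f T ∈ faceIdeal K D) :
    ∃ g h : Finset V → MvPolynomial V K, (∀ T, (g T).IsHomogeneous d) ∧
      (∀ T, (h T).IsHomogeneous d) ∧
      (∀ T, f T - koszulD (K := K) g T - X x * h T ∈ faceIdeal K D) ∧
      ∀ T, koszulD (K := K) h T ∈ faceIdeal K (faceStar D x) := by
  obtain ⟨g, hg, hgD⟩ := hdel d hd f hf fun T m hm hmD => hfD T m hm hmD.1
  have hsub : ∀ T, (f T - koszulD (K := K) g T).IsHomogeneous (d + 1) := fun T =>
    (hf T).sub (koszulD_isHomogeneous hg T)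
  choose h hh hhD using fun T => exists_eq_add_X_mul (hgD T) (hsub T)
  refine ⟨g, h, hg, hh, hhD, fun T => ?_⟩
  rw [← X_mul_mem_faceIdeal]
  -- Applying the differential kills the boundary of `g` and leaves `x` times the differential of
  -- `h`, modulo the ideal of `D`.
  have h1 := koszulD_mem (K := K) (N := MvPolynomial V K) (faceIdeal K D)
    (f := f - koszulD (K := K) g - (X x : MvPolynomial V K) • h) hhD T
  rw [map_sub, map_sub, koszulD_koszulD, sub_zero, map_smul, Pi.sub_apply] at h1
  have h2 := (faceIdeal K D).sub_mem (hfD T) h1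
  rwa [sub_sub_cancel] at h2

/-- Regularity from the star and the deletion of a vertex. -/
theorem QuotRegular.of_star_of_deletion {D : LowerSet (Finset V)} {x : V} {r : ℕ}
    (hstar : QuotRegular (faceIdeal K (faceStar D x)) r)
    (hdel : QuotRegular (faceIdeal K (faceDeletion D x)) (r + 1)) :
    QuotRegular (faceIdeal K D) (r + 1) := by
  intro d hd f hf hfD
  obtain ⟨g, h, hg, hh, hD, hhD⟩ := exists_koszul_decomposition hdel hd hf hfD
  -- Division by `x` has lowered the degree by one, so the bound `r` for the star suffices.
  obtain ⟨d, rfl⟩ : ∃ d', d = d' + 1 := ⟨d - 1, by omega⟩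
  obtain ⟨k, hk, hkD⟩ := hstar d (by omega) h hh hhD
  refine ⟨g + (X x : MvPolynomial V K) • k, fun T => ?_, fun T => ?_⟩
  · rw [Pi.add_apply, Pi.smul_apply, smul_eq_mul]
    exact (hg T).add (add_comm 1 d ▸ (isHomogeneous_X K x).mul (hk T))
  · have := (faceIdeal K D).add_mem (hD T) (X_mul_mem_faceIdeal.mpr (hkD T))
    convert this using 1
    simp only [map_add, map_smul, Pi.add_apply, Pi.smul_apply, smul_eq_mul]
    ring

/-- Regularity of a cone. -/
theorem QuotRegular.of_cone {D : LowerSet (Finset V)} {x : V} {r : ℕ}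
    (hcone : faceStar D x = D) (hdel : QuotRegular (faceIdeal K (faceDeletion D x)) r) :
    QuotRegular (faceIdeal K D) r := by
  intro d hd f hf hfD
  obtain ⟨g, h, hg, hh, hD, hhD⟩ := exists_koszul_decomposition hdel hd hf hfD
  rw [hcone] at hhD
  -- In a cone `h` is itself a cycle modulo the ideal of `D`, so the homotopy bounds `x * h` without
  -- loss of degree.
  refine ⟨g + koszulWedge (R := MvPolynomial V K) x h, fun T => ?_, fun T => ?_⟩
  · exact (hg T).add (koszulWedge_isHomogeneous x hh T)
  · have := (faceIdeal K D).add_mem (hD T) (koszulWedge_mem (faceIdeal K D) x hhD T)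
    have h2 := congrFun (koszulD_wedge (K := K) x h) T
    simp only [Pi.add_apply, Pi.smul_apply, smul_eq_mul] at h2
    convert this using 1
    simp only [map_add, Pi.add_apply]
    linear_combination -h2

/-- Only constants can survive in the quotient, and the chains considered have positive degree. -/
theorem QuotRegular.of_subset_empty {D : LowerSet (Finset V)} (h : ∀ T ∈ D, T = ∅) :
    QuotRegular (faceIdeal K D) 0 := by
  intro d _ f hf _
  refine ⟨0, fun T => isHomogeneous_zero _ _ _, fun T m hm hmD => ?_⟩
  rw [map_zero, Pi.zero_apply, sub_zero, mem_support_iff] at hm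
  have := hf T hm
  rw [Finsupp.support_eq_empty.mp (h _ hmD)] at this
  simp at this

/-- The polynomial ring on a subset of the variables has regularity zero. -/
theorem QuotRegular.faceIdeal_Iic (W : Finset V) :
    QuotRegular (faceIdeal K (LowerSet.Iic W)) 0 := by
  induction W using Finset.induction_on with
  | empty => exact .of_subset_empty fun T hT => Finset.subset_empty.mp hT
  | insert x W hx ih =>
    refine .of_cone (x := x) ?_ ?_
    · ext T
      simp [mem_faceStar, Finset.insert_subset_iff]
    · convert ih using 2
      ext T
      simp only [SetLike.mem_coe, mem_faceDeletion, LowerSet.mem_Iic_iff]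
      constructor
      · exact fun h => (Finset.subset_insert_iff_of_notMem h.2).mp h.1
      · exact fun h => ⟨h.trans (Finset.subset_insert _ _), fun h' => hx (h h')⟩

variable (V K) in
theorem QuotRegular.bot : QuotRegular (⊥ : Ideal (MvPolynomial V K)) 0 := by
  convert QuotRegular.faceIdeal_Iic (K := K) (Finset.univ : Finset V)
  ext p
  simp only [Ideal.mem_bot, mem_faceIdeal, LowerSet.mem_Iic_iff,
    Finset.subset_univ, not_true_eq_false, imp_false]
  rw [← Finset.eq_empty_iff_forall_notMem, support_eq_empty]

end StanleyReisner

/-! ### Minimal free resolutions from iterated syzygies -/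

section Syzygies

variable {V K : Type*} [Field K]

/-- The elements of degree `d` of the graded free module `⨁ₐ R(-deg a)`. -/
noncomputable def freeHomogeneous (V K : Type*) [Field K] {n : ℕ} (deg : Fin n → ℕ) (d : ℕ) :
    Submodule K (Fin n → MvPolynomial V K) :=
  Submodule.pi Set.univ fun a => if deg a ≤ d then homogeneousSubmodule V K (d - deg a) else ⊥

theorem mem_freeHomogeneous {n : ℕ} {deg : Fin n → ℕ} {d : ℕ} {p : Fin n → MvPolynomial V K} :
    p ∈ freeHomogeneous V K deg d ↔
      ∀ a, p a = 0 ∨ ∃ k, deg a + k = d ∧ (p a).IsHomogeneous k := by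
  simp only [freeHomogeneous, Submodule.mem_pi, Set.mem_univ, true_imp_iff]
  refine forall_congr' fun a => ?_
  split_ifs with h
  · rw [mem_homogeneousSubmodule]
    constructor
    · exact fun hp => Or.inr ⟨_, by omega, hp⟩
    · rintro (hp | ⟨k, rfl, hp⟩)
      · exact hp ▸ isHomogeneous_zero _ _ _
      · simpa using hp
  · rw [Submodule.mem_bot]
    refine ⟨Or.inl, ?_⟩
    rintro (hp | ⟨k, rfl, -⟩)
    · exact hp
    · omega

theorem smul_mem_freeHomogeneous {n : ℕ} {deg : Fin n → ℕ} {d k : ℕ} {c : MvPolynomial V K}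
    (hc : c.IsHomogeneous k) {p : Fin n → MvPolynomial V K} (hp : p ∈ freeHomogeneous V K deg d) :
    c • p ∈ freeHomogeneous V K deg (d + k) := by
  rw [mem_freeHomogeneous] at hp ⊢
  intro a
  rcases hp a with h | ⟨m, rfl, h⟩
  · exact Or.inl (by simp [h])
  · exact Or.inr ⟨m + k, by ring, by simpa [mul_comm] using h.mul hc⟩

theorem koszulD_mem_freeHomogeneous [Fintype V] [LinearOrder V] {n : ℕ} {deg : Fin n → ℕ} {d : ℕ}
    {f : Finset V → Fin n → MvPolynomial V K} (hf : ∀ T, f T ∈ freeHomogeneous V K deg d)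
    (T : Finset V) : koszulD (K := K) f T ∈ freeHomogeneous V K deg (d + 1) := by
  rw [koszulD_apply]
  refine Submodule.sum_mem _ fun v _ => smul_mem_freeHomogeneous (isHomogeneous_X K v) ?_
  rw [koszulContract_apply]
  split_ifs
  · exact Submodule.zero_mem _
  · exact zsmul_mem (hf _) _

theorem koszulD_apply_apply [Fintype V] [LinearOrder V] {n : ℕ}
    (f : Finset V → Fin n → MvPolynomial V K) (T : Finset V) (a : Fin n) :
    koszulD (K := K) f T a = koszulD (K := K) (fun T => f T a) T :=
  (koszulD_map (K := K) (LinearMap.proj (R := MvPolynomial V K) (φ := fun _ => MvPolynomial V K) a)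
    f T).symm

/-- The component of degree `d` of an element of the graded free module `⨁ₐ R(-deg a)`. -/
noncomputable def freeComponent {n : ℕ} (deg : Fin n → ℕ) (d : ℕ) :
    (Fin n → MvPolynomial V K) →ₗ[K] (Fin n → MvPolynomial V K) :=
  LinearMap.pi fun a =>
    if deg a ≤ d then (homogeneousComponent (d - deg a)).comp (LinearMap.proj a) else 0

theorem freeComponent_apply {n : ℕ} (deg : Fin n → ℕ) (d : ℕ) (p : Fin n → MvPolynomial V K)
    (a : Fin n) : freeComponent deg d p a =
      if deg a ≤ d then homogeneousComponent (d - deg a) (p a) else 0 := by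
  simp only [freeComponent, LinearMap.pi_apply]
  split_ifs <;> rfl

theorem freeComponent_mem {n : ℕ} (deg : Fin n → ℕ) (d : ℕ) (p : Fin n → MvPolynomial V K) :
    freeComponent deg d p ∈ freeHomogeneous V K deg d := by
  rw [mem_freeHomogeneous]
  intro a
  rw [freeComponent_apply]
  split_ifs with h
  · exact Or.inr ⟨_, by omega, homogeneousComponent_isHomogeneous _ _⟩
  · exact Or.inl rfl

theorem freeComponent_eq_self {n : ℕ} {deg : Fin n → ℕ} {d : ℕ} {p : Fin n → MvPolynomial V K}
    (hp : p ∈ freeHomogeneous V K deg d) : freeComponent deg d p = p := by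
  rw [mem_freeHomogeneous] at hp
  ext1 a
  rw [freeComponent_apply]
  rcases hp a with h | ⟨m, rfl, h⟩
  · simp [h]
  · simpa using homogeneousComponent_eq_self h

theorem exists_sum_freeComponent {n : ℕ} (deg : Fin n → ℕ) (p : Fin n → MvPolynomial V K) :
    ∃ m, ∑ d ∈ Finset.range m, freeComponent deg d p = p := by
  classical
  refine ⟨(Finset.univ.sup fun a => deg a + (p a).totalDegree) + 1, ?_⟩
  ext1 a
  have hle : deg a + (p a).totalDegree ≤ Finset.univ.sup fun a => deg a + (p a).totalDegree :=
    Finset.le_sup (f := fun a => deg a + (p a).totalDegree) (Finset.mem_univ a)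
  set m := Finset.univ.sup fun a => deg a + (p a).totalDegree
  rw [Finset.sum_apply]
  simp only [freeComponent_apply]
  obtain ⟨k, hk⟩ : ∃ k, m + 1 = deg a + ((p a).totalDegree + 1 + k) :=
    ⟨m - deg a - (p a).totalDegree, by omega⟩
  -- Components below `deg a` vanish by definition, those beyond the total degree because the
  -- polynomial has none.
  rw [hk, Finset.sum_range_add, Finset.sum_range_add]
  have h1 : ∑ x ∈ Finset.range (deg a), (if deg a ≤ x then
      homogeneousComponent (x - deg a) (p a) else 0) = 0 :=
    Finset.sum_eq_zero fun x hx => if_neg (by simpa using hx)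
  have h2 : ∑ x ∈ Finset.range k, (if deg a ≤ deg a + ((p a).totalDegree + 1 + x) then
      homogeneousComponent (deg a + ((p a).totalDegree + 1 + x) - deg a) (p a) else 0) = 0 := by
    refine Finset.sum_eq_zero fun x hx => ?_
    rw [if_pos (by omega), homogeneousComponent_eq_zero _ _ (by omega)]
  rw [h1, h2, zero_add, add_zero]
  conv_rhs => rw [← sum_homogeneousComponent (p a)]
  simp

theorem homogeneousComponent_mul_of_isHomogeneous {p : MvPolynomial V K} {m : ℕ}
    (hp : p.IsHomogeneous m) (c : MvPolynomial V K) (d : ℕ) :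
    homogeneousComponent d (c * p) =
      if m ≤ d then homogeneousComponent (d - m) c * p else 0 := by
  let _ := gradedAlgebra (σ := V) (R := K)
  have h := DirectSum.coe_decompose_mul_of_right_mem (homogeneousSubmodule V K) d (a := c) hp
  have e : ∀ (q : MvPolynomial V K) (i : ℕ),
      (DirectSum.decompose (homogeneousSubmodule V K) q i : MvPolynomial V K) =
        homogeneousComponent i q := decomposition.decompose'_apply
  rwa [e, e] at h

theorem freeComponent_smul {n : ℕ} {deg : Fin n → ℕ} {m : ℕ} {p : Fin n → MvPolynomial V K}
    (hp : p ∈ freeHomogeneous V K deg m) (c : MvPolynomial V K) (d : ℕ) :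
    freeComponent deg d (c • p) =
      (if m ≤ d then homogeneousComponent (d - m) c else 0) • p := by
  rw [mem_freeHomogeneous] at hp
  ext1 a
  rw [freeComponent_apply, Pi.smul_apply, Pi.smul_apply, smul_eq_mul, smul_eq_mul]
  rcases hp a with h | ⟨k, rfl, h⟩
  · simp [h]
  · rw [homogeneousComponent_mul_of_isHomogeneous h]
    by_cases h1 : deg a + k ≤ d
    · rw [if_pos (by omega), if_pos (by omega), if_pos h1, Nat.sub_sub]
    · rw [if_neg h1, zero_mul]
      split_ifs
      · omega
      · rfl
      · rfl

/-- A homomorphism of graded free modules commutes with taking components. -/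
theorem freeComponent_map {n k : ℕ} {deg : Fin n → ℕ} {deg' : Fin k → ℕ}
    {φ : (Fin k → MvPolynomial V K) →ₗ[MvPolynomial V K] (Fin n → MvPolynomial V K)}
    (hφ : ∀ b, φ (Pi.single b 1) ∈ freeHomogeneous V K deg (deg' b)) (d : ℕ)
    (c : Fin k → MvPolynomial V K) :
    freeComponent deg d (φ c) = φ (freeComponent deg' d c) := by
  have h : ∀ c, φ c = ∑ b, c b • φ (Pi.single b 1) := fun c => by
    conv_lhs => rw [pi_eq_sum_univ' c]
    simp [map_sum]
  rw [h, h, map_sum]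
  refine Finset.sum_congr rfl fun b _ => ?_
  rw [freeComponent_smul (hφ b), freeComponent_apply]

theorem map_mem_freeHomogeneous {n k : ℕ} {deg : Fin n → ℕ} {deg' : Fin k → ℕ}
    {φ : (Fin k → MvPolynomial V K) →ₗ[MvPolynomial V K] (Fin n → MvPolynomial V K)}
    (hφ : ∀ b, φ (Pi.single b 1) ∈ freeHomogeneous V K deg (deg' b)) {d : ℕ}
    {c : Fin k → MvPolynomial V K} (hc : c ∈ freeHomogeneous V K deg' d) :
    φ c ∈ freeHomogeneous V K deg d := by
  rw [← freeComponent_eq_self hc, ← freeComponent_map hφ]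
  exact freeComponent_mem _ _ _

variable (V K) [Fintype V] [LinearOrder V]

/-- A homogeneous submodule of a graded free module, of regularity at most `r`: its Koszul
homology in homological degree `i` vanishes in all internal degrees above `i + r`. -/
structure RegularSubmodule (r : ℕ) where
  /-- the rank of the ambient free module -/
  rank : ℕ
  /-- the degrees of the basis elements of the ambient free module -/
  deg : Fin rank → ℕ
  /-- the submodule -/
  carrier : Submodule (MvPolynomial V K) (Fin rank → MvPolynomial V K)
  component_mem : ∀ d, ∀ p ∈ carrier, freeComponent deg d p ∈ carrier
  regular : ∀ d, r ≤ d → ∀ f : Finset V → Fin rank → MvPolynomial V K,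
    (∀ T, f T ∈ freeHomogeneous V K deg (d + 1)) → (∀ T, f T ∈ carrier) →
    koszulD (K := K) f = 0 → ∃ g : Finset V → Fin rank → MvPolynomial V K,
      (∀ T, g T ∈ freeHomogeneous V K deg d) ∧ (∀ T, g T ∈ carrier) ∧ koszulD (K := K) g = f

variable {V K}

namespace RegularSubmodule

variable {r : ℕ} (N : RegularSubmodule V K r)

/-- The generators provided by a regularity bound. -/
def homogeneousElements : Set (Fin N.rank → MvPolynomial V K) :=
  {p | p ∈ N.carrier ∧ ∃ d ≤ r, p ∈ freeHomogeneous V K N.deg d}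

/-- Koszul homology in homological degree zero is the module modulo the variables; its vanishing
above `r` pushes elements down to degree `r`. -/
theorem mem_span_of_mem_freeHomogeneous (d : ℕ) : ∀ p ∈ N.carrier,
    p ∈ freeHomogeneous V K N.deg d →
    p ∈ Submodule.span (MvPolynomial V K) N.homogeneousElements := by
  induction d with
  | zero => exact fun p hp hd => Submodule.subset_span ⟨hp, 0, Nat.zero_le _, hd⟩
  | succ d ih =>
    intro p hp hd
    by_cases hr : d + 1 ≤ r
    · exact Submodule.subset_span ⟨hp, d + 1, hr, hd⟩
    -- A chain concentrated at `∅` is a cycle, since contraction only reads nonempty sets.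
    obtain ⟨g, hg, hgN, hgp⟩ := N.regular d (by omega) (Pi.single ∅ p)
      (fun T => by
        by_cases h : T = ∅
        · subst h; simpa using hd
        · simp [h])
      (fun T => by
        by_cases h : T = ∅
        · subst h; simpa using hp
        · simp [h])
      (by
        ext1 T
        rw [koszulD_apply, Pi.zero_apply]
        refine Finset.sum_eq_zero fun v _ => ?_
        rw [koszulContract_apply]
        split_ifs <;> simp)
    have := congrFun hgp ∅
    rw [Pi.single_eq_same] at this
    rw [← this]
    exact koszulD_mem _ (fun T => ih _ (hgN T) (hg T)) ∅

theorem span_homogeneousElements :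
    Submodule.span (MvPolynomial V K) N.homogeneousElements = N.carrier := by
  refine le_antisymm (Submodule.span_le.mpr fun p hp => hp.1) fun p hp => ?_
  obtain ⟨m, hm⟩ := exists_sum_freeComponent N.deg p
  rw [← hm]
  exact Submodule.sum_mem _ fun d _ =>
    N.mem_span_of_mem_freeHomogeneous d _ (N.component_mem d p hp) (freeComponent_mem _ _ _)

/-- A minimal graded free cover. -/
structure MinimalCover where
  /-- the rank of the free module -/
  rank : ℕ
  /-- the degrees of the basis elements -/
  deg : Fin rank → ℕ
  deg_le : ∀ b, deg b ≤ r
  /-- the covering map -/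
  map : (Fin rank → MvPolynomial V K) →ₗ[MvPolynomial V K] (Fin N.rank → MvPolynomial V K)
  map_single : ∀ b, map (Pi.single b 1) ∈ freeHomogeneous V K N.deg (deg b)
  range_map : LinearMap.range map = N.carrier
  minimal : ∀ c, map c = 0 → ∀ b, constantCoeff (c b) = 0

theorem exists_finite_generators : ∃ (k : ℕ) (b : Fin k → Fin N.rank → MvPolynomial V K),
    (∀ i, b i ∈ N.homogeneousElements) ∧
      Submodule.span (MvPolynomial V K) (Set.range b) = N.carrier := by
  have hfg : N.carrier.FG := IsNoetherian.noetherian _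
  rw [← N.span_homogeneousElements, Submodule.fg_span_iff_fg_span_finset_subset] at hfg
  obtain ⟨s, hs, hspan⟩ := hfg
  refine ⟨s.card, fun i => s.equivFin.symm i, fun i => hs (s.equivFin.symm i).2, ?_⟩
  rw [← N.span_homogeneousElements, hspan]
  congr 1
  ext p
  constructor
  · rintro ⟨i, rfl⟩
    exact (s.equivFin.symm i).2
  · exact fun hp => ⟨s.equivFin ⟨p, hp⟩, by simp⟩

/-- Take the least possible number of generators: a relation with a nonzero constant term would make
one of them superfluous. -/
theorem nonempty_minimalCover : Nonempty N.MinimalCover := by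
  classical
  have hex := N.exists_finite_generators
  obtain ⟨b, hb, hspan⟩ := Nat.find_spec hex
  have hmin := fun m => Nat.find_min hex (m := m)
  generalize Nat.find hex = k at b hb hspan hmin
  choose hbN deg hdeg hbdeg using hb
  have hsingle : ∀ i, Fintype.linearCombination (MvPolynomial V K) b (Pi.single i 1) = b i :=
    fun i => by simp [Fintype.linearCombination_apply_single]
  refine ⟨⟨k, deg, hdeg, Fintype.linearCombination (MvPolynomial V K) b, fun i => ?_, ?_, ?_⟩⟩
  · rw [hsingle]; exact hbdeg i
  · rw [Fintype.range_linearCombination, hspan]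
  · intro c hc i
    by_contra hi
    obtain ⟨k, rfl⟩ : ∃ k', k = k' + 1 :=
      ⟨k - 1, by have := i.2; omega⟩
    refine hmin k (by omega) ⟨b ∘ i.succAbove, fun j => ⟨hbN _, deg _, hdeg _, hbdeg _⟩, ?_⟩
    refine le_antisymm (hspan ▸ Submodule.span_mono (Set.range_comp_subset_range _ _)) ?_
    rw [← hspan, Submodule.span_le]
    rintro _ ⟨j, rfl⟩
    by_cases hj : j = i
    swap
    · obtain ⟨l, rfl⟩ := Fin.exists_succAbove_eq hj
      exact Submodule.subset_span ⟨l, rfl⟩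
    subst hj
    -- In the component of degree `deg j` of the relation, the coefficient of `b j` is its constant
    -- term, hence invertible.
    have h := freeComponent_map (φ := Fintype.linearCombination (MvPolynomial V K) b)
      (deg := N.deg) (deg' := deg) (fun i => by rw [hsingle]; exact hbdeg i) (deg j) c
    rw [hc, map_zero, Fintype.linearCombination_apply, Fin.sum_univ_succAbove _ j,
      freeComponent_apply, if_pos le_rfl, Nat.sub_self, homogeneousComponent_zero] at h
    rw [constantCoeff_eq] at hi
    have h3 : b j = (C (coeff 0 (c j))⁻¹ : MvPolynomial V K) • -∑ l : Fin k,
        freeComponent deg (deg j) c (j.succAbove l) • b (j.succAbove l) := by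
      rw [← eq_neg_of_add_eq_zero_left h.symm, smul_smul, ← C_mul, inv_mul_cancel₀ hi, C_1,
        one_smul]
    rw [h3]
    refine Submodule.smul_mem _ _ (Submodule.neg_mem _ (Submodule.sum_mem _ fun l _ =>
      Submodule.smul_mem _ _ (Submodule.subset_span ⟨l, rfl⟩)))

/-- A chosen minimal graded free cover. -/
noncomputable def cover : N.MinimalCover := Classical.choice N.nonempty_minimalCover

/-- Coordinatewise this is acyclicity of the Koszul complex of the polynomial ring in positive
coefficient degree. -/
theorem exists_koszulD_eq_of_deg_le {n : ℕ} {deg : Fin n → ℕ} {d : ℕ} (hd : ∀ b, deg b ≤ d)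
    {f : Finset V → Fin n → MvPolynomial V K}
    (hf : ∀ T, f T ∈ freeHomogeneous V K deg (d + 1)) (hcycle : koszulD (K := K) f = 0) :
    ∃ g : Finset V → Fin n → MvPolynomial V K,
      (∀ T, g T ∈ freeHomogeneous V K deg d) ∧ koszulD (K := K) g = f := by
  have key : ∀ b, ∃ g : Finset V → MvPolynomial V K,
      (∀ T, (g T).IsHomogeneous (d - deg b)) ∧ ∀ T, koszulD (K := K) g T = f T b := by
    intro b
    obtain ⟨g, hg, h⟩ := QuotRegular.bot V K (d - deg b) (Nat.zero_le _) (fun T => f T b)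
      (fun T => by
        rcases mem_freeHomogeneous.mp (hf T) b with h | ⟨k, hk, h⟩
        · rw [h]; exact isHomogeneous_zero _ _ _
        · have := hd b
          obtain rfl : k = d - deg b + 1 := by omega
          exact h)
      (fun T => by
        rw [← koszulD_apply_apply, hcycle]; simp)
    exact ⟨g, hg, fun T => (sub_eq_zero.mp ((Ideal.mem_bot).mp (h T))).symm⟩
  choose g hg h using key
  refine ⟨fun T b => g b T, fun T => mem_freeHomogeneous.mpr fun b =>
    Or.inr ⟨d - deg b, Nat.add_sub_cancel' (hd b), hg b T⟩, ?_⟩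
  ext1 T
  ext1 b
  rw [← h b T]
  exact koszulD_apply_apply _ _ _

/-- The first syzygies, in a minimal cover, of a submodule of regularity `r` have
regularity `r + 1`. -/
noncomputable def syzygies : RegularSubmodule V K (r + 1) where
  rank := N.cover.rank
  deg := N.cover.deg
  carrier := LinearMap.ker N.cover.map
  component_mem d p hp := by
    rw [LinearMap.mem_ker] at hp ⊢
    rw [← freeComponent_map N.cover.map_single, hp, map_zero]
  regular d hd f hf hfN hcycle := by
    have hle := N.cover.deg_le
    -- The connecting map of syzygies → cover → module: bound `f` by `g` in the cover, bound the
    -- image of `g` by `h` in the module, lift `h` to `c` and correct `g` by the boundary of `c`.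
    obtain ⟨g, hg, hgf⟩ := exists_koszulD_eq_of_deg_le (fun b => (hle b).trans (by omega)) hf hcycle
    obtain ⟨d, rfl⟩ : ∃ d', d = d' + 1 := ⟨d - 1, by omega⟩
    obtain ⟨h, hh, hhN, hhg⟩ := N.regular d (by omega) (fun T => N.cover.map (g T))
      (fun T => map_mem_freeHomogeneous N.cover.map_single (hg T))
      (fun T => N.cover.range_map ▸ LinearMap.mem_range_self _ _)
      (by ext1 T; rw [koszulD_map, hgf]; exact hfN T)
    have hlift : ∀ T, ∃ c ∈ freeHomogeneous V K N.cover.deg d, N.cover.map c = h T := by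
      intro T
      obtain ⟨c, hc⟩ : h T ∈ LinearMap.range N.cover.map := N.cover.range_map ▸ hhN T
      refine ⟨freeComponent N.cover.deg d c, freeComponent_mem _ _ _, ?_⟩
      rw [← freeComponent_map N.cover.map_single, hc, freeComponent_eq_self (hh T)]
    choose c hc hch using hlift
    refine ⟨g - koszulD (K := K) c, fun T =>
      Submodule.sub_mem _ (hg T) (koszulD_mem_freeHomogeneous hc T), fun T => ?_, ?_⟩
    · rw [LinearMap.mem_ker, Pi.sub_apply, map_sub, ← koszulD_map, funext hch, hhg, sub_self]
    · rw [map_sub, koszulD_koszulD, sub_zero, hgf]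

theorem exact_cover : Function.Exact N.syzygies.cover.map N.cover.map :=
  fun c => (SetLike.ext_iff.mp N.syzygies.cover.range_map c).symm

/-- The iterated syzygies. -/
noncomputable def iterateSyzygies : (i : ℕ) → RegularSubmodule V K (r + i)
  | 0 => N
  | i + 1 => (iterateSyzygies i).syzygies

/-- A homogeneous ideal as a submodule of the free module of rank one. -/
noncomputable def ofIdeal (I : Ideal (MvPolynomial V K)) (hI : ∀ p ∈ I, ∀ d, homogeneousComponent d p ∈ I)
    (hr : QuotRegular I r) : RegularSubmodule V K (r + 1) where
  rank := 1
  deg := fun _ => 0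
  carrier := Submodule.comap (LinearMap.proj 0) I
  component_mem d p hp := by
    rw [Submodule.mem_comap, LinearMap.proj_apply, freeComponent_apply, if_pos (Nat.zero_le _)]
    exact hI _ hp _
  regular d hd f hf hfN hcycle := by
    obtain ⟨d, rfl⟩ : ∃ d', d = d' + 1 := ⟨d - 1, by omega⟩
    -- The same chase for the ideal, the ring and the quotient.
    obtain ⟨g, hg, hgf⟩ := exists_koszulD_eq_of_deg_le (fun b => Nat.zero_le _) hf hcycle
    obtain ⟨h, hh, hhg⟩ := hr d (by omega) (fun T => g T 0)
      (fun T => by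
        rcases mem_freeHomogeneous.mp (hg T) 0 with h | ⟨k, hk, h⟩
        · rw [h]; exact isHomogeneous_zero _ _ _
        · obtain rfl : k = d + 1 := by omega
          exact h)
      (fun T => by
        rw [← koszulD_apply_apply, hgf]
        exact hfN T)
    refine ⟨g - koszulD (K := K) fun T _ => h T, fun T => Submodule.sub_mem _ (hg T)
      (koszulD_mem_freeHomogeneous (fun T => mem_freeHomogeneous.mpr fun a =>
        Or.inr ⟨d, by omega, hh T⟩) T), fun T => ?_, ?_⟩
    · rw [Submodule.mem_comap, LinearMap.proj_apply, Pi.sub_apply, Pi.sub_apply,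
        koszulD_apply_apply]
      exact hhg T
    · rw [map_sub, koszulD_koszulD, sub_zero, hgf]

/-- The minimal graded free resolution by iterated syzygies. -/
noncomputable def resolution (I : Ideal (MvPolynomial V K))
    (hI : ∀ p ∈ I, ∀ d, homogeneousComponent d p ∈ I) (hr : QuotRegular I r) :
    MinimalGradedFreeResolution I where
  -- The zeroth module sits in the ring itself, so `F_i` is the ambient module of the syzygies with
  -- index `i + 1`.
  rank i := ((ofIdeal I hI hr).iterateSyzygies (i + 1)).rank
  deg i := ((ofIdeal I hI hr).iterateSyzygies (i + 1)).deg
  aug := (LinearMap.proj (0 : Fin 1)).comp (ofIdeal I hI hr).cover.map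
  d i := ((ofIdeal I hI hr).iterateSyzygies (i + 1)).cover.map
  aug_homogeneous a := by
    change ((ofIdeal I hI hr).cover.map (Pi.single a 1) (0 : Fin 1)).IsHomogeneous
      ((ofIdeal I hI hr).cover.deg a)
    rcases mem_freeHomogeneous.mp ((ofIdeal I hI hr).cover.map_single a) (0 : Fin 1) with
      h | ⟨k, hk, h⟩
    · exact h.symm ▸ isHomogeneous_zero _ _ _
    · exact (Nat.zero_add k).symm.trans hk ▸ h
  d_homogeneous i b := mem_freeHomogeneous.mp
    (((ofIdeal I hI hr).iterateSyzygies (i + 1)).cover.map_single b)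
  range_aug := by
    ext p
    constructor
    · rintro ⟨c, rfl⟩
      exact (SetLike.ext_iff.mp (ofIdeal I hI hr).cover.range_map _).mp ⟨c, rfl⟩
    · intro hp
      obtain ⟨c, hc⟩ := (SetLike.ext_iff.mp (ofIdeal I hI hr).cover.range_map fun _ => p).mpr hp
      exact ⟨c, congrFun hc (0 : Fin 1)⟩
  exact_zero c := by
    refine Iff.trans ⟨fun h => ?_, fun h => congrFun h (0 : Fin 1)⟩
      ((ofIdeal I hI hr).exact_cover c)
    ext1 a
    rw [Subsingleton.elim (α := Fin 1) a 0]
    exact h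
  exact_succ i := ((ofIdeal I hI hr).iterateSyzygies (i + 1)).exact_cover
  minimal i b a :=
    ((ofIdeal I hI hr).iterateSyzygies i).cover.minimal _
      ((((ofIdeal I hI hr).iterateSyzygies i).exact_cover _).mpr ⟨Pi.single b 1, rfl⟩) a

end RegularSubmodule

/-- The regularity of a homogeneous ideal is one more than that of its quotient ring. -/
theorem castelnuovoMumfordRegularity_le {I : Ideal (MvPolynomial V K)} {r : ℕ}
    (hI : ∀ p ∈ I, ∀ d, homogeneousComponent d p ∈ I) (hr : QuotRegular I r) :
    castelnuovoMumfordRegularity I ≤ ((r + 1 : ℕ) : EReal) := by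
  -- Regularity is an infimum over resolutions, so a single one bounds it.
  refine iInf_le_of_le (RegularSubmodule.resolution I hI hr) ?_
  refine iSup_le fun i => iSup_le fun j => iSup_le fun h => ?_
  obtain ⟨⟨a, rfl⟩⟩ := (Nat.card_ne_zero.mp h).1
  have hle : (RegularSubmodule.resolution I hI hr).deg i a ≤ r + 1 + i :=
    ((RegularSubmodule.ofIdeal I hI hr).iterateSyzygies i).cover.deg_le a
  have : (((RegularSubmodule.resolution I hI hr).deg i a : ℝ) - (i : ℝ)) ≤ ((r + 1 : ℕ) : ℝ) := by
    rw [sub_le_iff_le_add]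
    exact_mod_cast hle
  exact_mod_cast this

end Syzygies

theorem homogeneousComponent_mem_faceIdeal {V K : Type*} [Field K] {D : LowerSet (Finset V)}
    {p : MvPolynomial V K} (hp : p ∈ faceIdeal K D) (d : ℕ) :
    homogeneousComponent d p ∈ faceIdeal K D := by
  intro m hm
  rw [support_homogeneousComponent, Finset.mem_filter] at hm
  exact hp m hm.1

/-! ### Chordal graphs and Dirac's theorem -/

section Dirac

variable {V : Type*}

/-- The restriction of a graph to the edges inside `A`. -/
def SimpleGraph.within (H : SimpleGraph V) (A : Set V) : SimpleGraph V where
  Adj x y := x ∈ A ∧ y ∈ A ∧ H.Adj x y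
  symm := ⟨fun _ _ h => ⟨h.2.1, h.1, h.2.2.symm⟩⟩
  loopless := ⟨fun _ h => h.2.2.ne rfl⟩

/-- There is no induced cycle of length at least four inside `A`. -/
def SimpleGraph.ChordalOn (H : SimpleGraph V) (A : Set V) : Prop :=
  ∀ n, 4 ≤ n → ∀ f : SimpleGraph.cycleGraph n ↪g H, ¬ ∀ i, f i ∈ A

/-- The neighbours of `s` in `A` form a clique. -/
def SimpleGraph.SimplicialIn (H : SimpleGraph V) (s : V) (A : Set V) : Prop :=
  H.IsClique {w | w ∈ A ∧ H.Adj s w}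

variable {H : SimpleGraph V}

theorem SimpleGraph.ChordalOn.mono {A B : Set V} (h : H.ChordalOn B) (hAB : A ⊆ B) :
    H.ChordalOn A :=
  fun n hn f hf => h n hn f fun i => hAB (hf i)

theorem SimpleGraph.within_mono {A B : Set V} (hAB : A ⊆ B) : H.within A ≤ H.within B :=
  fun _ _ h => ⟨hAB h.1, hAB h.2.1, h.2.2⟩

/-- Two vertices connected inside `A` are connected by an induced path inside `A`. -/
theorem exists_induced_path {A : Set V} {a b : V} (ha : a ∈ A)
    (h : (H.within A).Reachable a b) :
    ∃ (L : ℕ) (p : ℕ → V), p 0 = a ∧ p L = b ∧ (∀ i ≤ L, p i ∈ A) ∧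
      (∀ i ≤ L, ∀ j ≤ L, p i = p j → i = j) ∧
      ∀ i j, i < j → j ≤ L → (H.Adj (p i) (p j) ↔ j = i + 1) := by
  obtain ⟨w, hw⟩ := h.exists_walk_length_eq_dist
  have hmem : ∀ i ≤ w.length, w.getVert i ∈ A := by
    intro i hi
    rcases Nat.eq_zero_or_pos i with rfl | hpos
    · simpa using ha
    · have := w.adj_getVert_succ (i := i - 1) (by omega)
      rw [Nat.sub_add_cancel hpos] at this
      exact this.2.1
  refine ⟨w.length, w.getVert, w.getVert_zero, w.getVert_length, hmem, ?_, ?_⟩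
  · intro i hi j hj hij
    exact (w.isPath_of_length_eq_dist hw).getVert_injOn hi hj hij
  · intro i j hij hj
    constructor
    · intro hadj
      have hadj' : (H.within A).Adj (w.getVert i) (w.getVert j) :=
        ⟨hmem i (by omega), hmem j hj, hadj⟩
      -- A chord would shortcut a shortest walk.
      have := SimpleGraph.dist_le ((w.take i).append (SimpleGraph.Walk.cons hadj' (w.drop j)))
      rw [SimpleGraph.Walk.length_append, SimpleGraph.Walk.length_cons,
        SimpleGraph.Walk.take_length, SimpleGraph.Walk.drop_length, ← hw] at this
      omega
    · rintro rfl
      exact (w.adj_getVert_succ (by omega)).2.2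

theorem cycleGraph_adj_iff_val {n : ℕ} (hn : 3 ≤ n) (u v : Fin n) :
    (SimpleGraph.cycleGraph n).Adj u v ↔
      u.val + 1 = v.val ∨ v.val + 1 = u.val ∨ (u.val = 0 ∧ v.val + 1 = n) ∨
        (v.val = 0 ∧ u.val + 1 = n) := by
  rw [SimpleGraph.cycleGraph_adj']
  have hu := u.2
  have hv := v.2
  rcases lt_trichotomy u v with h | h | h
  · rw [Fin.sub_val_of_le h.le, Fin.coe_sub_iff_lt.mpr h]
    have : u.val < v.val := h
    omega
  · subst h
    have : NeZero n := ⟨by omega⟩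
    simp only [sub_self, Fin.val_zero]
    omega
  · rw [Fin.sub_val_of_le h.le, Fin.coe_sub_iff_lt.mpr h]
    have : v.val < u.val := h
    omega

/-- Two nonadjacent neighbours of `v` which are connected through non-neighbours of `v` lie on
an induced cycle through `v`. -/
theorem not_chordalOn_of_reachable {A : Set V} {v a b : V} (hva : H.Adj v a) (hvb : H.Adj v b)
    (hab : a ≠ b) (hnab : ¬H.Adj a b) (ha : a ∈ A) (hvA : v ∉ A)
    (hA : ∀ c ∈ A, c ≠ a → c ≠ b → ¬H.Adj v c) (h : (H.within A).Reachable a b) :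
    ¬H.ChordalOn (insert v A) := by
  obtain ⟨L, p, h0, hL, hpA, hinj, hadj⟩ := exists_induced_path ha h
  have hL2 : 2 ≤ L := by
    by_contra hlt
    obtain rfl | rfl : L = 0 ∨ L = 1 := by omega
    · exact hab (h0.symm.trans hL)
    · exact hnab (h0 ▸ hL ▸ (hadj 0 1 (by omega) le_rfl).mpr rfl)
  have hpv : ∀ i ≤ L, p i ≠ v := fun i hi hv => hvA (hv ▸ hpA i hi)
  have hadjv : ∀ i ≤ L, (H.Adj v (p i) ↔ i = 0 ∨ i = L) := by
    intro i hi
    constructor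
    · intro hi'
      by_contra! hne
      refine hA _ (hpA i hi) (fun e => hne.1 ?_) (fun e => hne.2 ?_) hi'
      · exact hinj i hi 0 (by omega) (e.trans h0.symm)
      · exact hinj i hi L le_rfl (e.trans hL.symm)
    · rintro (rfl | rfl)
      · rwa [h0]
      · rwa [hL]
  have hadj' : ∀ i ≤ L, ∀ j ≤ L, (H.Adj (p i) (p j) ↔ i + 1 = j ∨ j + 1 = i) := by
    intro i hi j hj
    rcases lt_trichotomy i j with hij | rfl | hij
    · rw [hadj i j hij hj]; omega
    · simp
    · rw [H.adj_comm, hadj j i hij hi]; omega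
  intro hch
  -- The path occupies the positions up to `L`, and `v` closes the cycle at position `L + 1`.
  refine hch (L + 2) (by omega) ⟨⟨fun i => if i.val ≤ L then p i else v, ?_⟩, ?_⟩ ?_
  · intro i j hij
    have hi := i.2
    have hj := j.2
    simp only at hij
    apply Fin.ext
    split_ifs at hij with h1 h2 h2
    · exact hinj _ h1 _ h2 hij
    · exact (hpv _ h1 hij).elim
    · exact (hpv _ h2 hij.symm).elim
    · omega
  · intro i j
    rw [cycleGraph_adj_iff_val (by omega)]
    have hi := i.2
    have hj := j.2
    change H.Adj (if i.val ≤ L then p i else v) (if j.val ≤ L then p j else v) ↔ _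
    split_ifs with h1 h2 h2
    · rw [hadj' _ h1 _ h2]; omega
    · rw [H.adj_comm, hadjv _ h1]; omega
    · rw [hadjv _ h2]; omega
    · simp only [SimpleGraph.irrefl, false_iff]; omega
  · intro i
    change (if i.val ≤ L then p i else v) ∈ _
    split_ifs with h1
    · exact Or.inr (hpA _ h1)
    · exact Or.inl rfl

/-- Every vertex passed on the way from `u` is itself reachable from `u`. -/
theorem reachable_within_component {U : Set V} {u w : V} (hu : u ∈ U)
    (h : (H.within U).Reachable u w) :
    w ∈ U ∧ (H.within {x | (H.within U).Reachable u x}).Reachable u w := by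
  have h' := h
  rw [SimpleGraph.reachable_iff_reflTransGen] at h'
  induction h' with
  | refl => exact ⟨hu, .refl _⟩
  | @tail x y hx hxy ih =>
    have hx' : (H.within U).Reachable u x := (SimpleGraph.reachable_iff_reflTransGen _ _).mpr hx
    refine ⟨hxy.2.1, (ih hx').2.trans (SimpleGraph.Adj.reachable ?_)⟩
    exact ⟨hx', h, hxy.2.2⟩

/-- **Dirac's theorem**: in a chordal graph, a vertex which is not adjacent to all others has a
simplicial non-neighbour. -/
theorem exists_simplicial_not_adj (W : Finset V) : H.ChordalOn W → ∀ v ∈ W,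
    (∃ u ∈ W, u ≠ v ∧ ¬H.Adj v u) → ∃ s ∈ W, s ≠ v ∧ ¬H.Adj v s ∧ H.SimplicialIn s W := by
  classical
  induction W using Finset.strongInduction with
  | H W ih =>
  rintro hch v hv ⟨u, huW, huv, hnuv⟩
  set U : Set V := {w | w ∈ W ∧ w ≠ v ∧ ¬H.Adj v w} with hU
  have huU : u ∈ U := ⟨huW, huv, hnuv⟩
  set C : Set V := {x | (H.within U).Reachable u x} with hC
  have hCU : ∀ c ∈ C, c ∈ U := fun c hc => (reachable_within_component huU hc).1
  have huC : u ∈ C := SimpleGraph.Reachable.refl u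
  set S : Set V := {s | s ∈ W ∧ s ∉ C ∧ ∃ c ∈ C, H.Adj s c} with hS
  have hSv : ∀ s ∈ S, H.Adj v s := by
    rintro s ⟨hsW, hsC, c, hc, hsc⟩
    by_contra hns
    refine hsC (SimpleGraph.Reachable.trans hc (SimpleGraph.Adj.reachable ?_))
    refine ⟨hCU c hc, ⟨hsW, ?_, hns⟩, hsc.symm⟩
    rintro rfl
    exact (hCU c hc).2.2 hsc
  -- Nonadjacent `a` and `b` would be joined through `C`, which consists of non-neighbours of `v`,
  -- and so close an induced cycle at `v`.
  have hSclique : ∀ a ∈ S, ∀ b ∈ S, a ≠ b → H.Adj a b := by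
    intro a ha b hb hab
    by_contra hnab
    obtain ⟨c, hc, hac⟩ := ha.2.2
    obtain ⟨c', hc', hbc⟩ := hb.2.2
    have hsub : C ⊆ C ∪ {a, b} := Set.subset_union_left
    have haA : a ∈ C ∪ {a, b} := by simp
    have hbA : b ∈ C ∪ {a, b} := by simp
    have h1 : ∀ x ∈ C, (H.within (C ∪ {a, b})).Reachable u x := fun x hx =>
      (reachable_within_component huU hx).2.mono (SimpleGraph.within_mono hsub)
    have h2 : (H.within (C ∪ {a, b})).Reachable a b := by
      refine (SimpleGraph.Adj.reachable ?_).trans ((h1 c hc).symm.trans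
        ((h1 c' hc').trans (SimpleGraph.Adj.reachable ?_)))
      · exact ⟨haA, hsub hc, hac⟩
      · exact ⟨hsub hc', hbA, hbc.symm⟩
    refine not_chordalOn_of_reachable (hSv a ha) (hSv b hb) hab hnab haA ?_ ?_ h2 (hch.mono ?_)
    · rintro (hvC | rfl | rfl)
      · exact (hCU v hvC).2.1 rfl
      · exact (hSv _ ha).ne rfl
      · exact (hSv _ hb).ne rfl
    · rintro x (hx | rfl | rfl) hxa hxb
      · exact (hCU x hx).2.2
      · exact (hxa rfl).elim
      · exact (hxb rfl).elim
    · rintro x (rfl | hx | rfl | rfl)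
      exacts [hv, (hCU x hx).1, ha.1, hb.1]
  -- All neighbours in `W` of a vertex of `C` lie in `C ∪ S`.
  suffices h : ∃ s ∈ C, H.SimplicialIn s (C ∪ S) by
    obtain ⟨s, hs, hsimp⟩ := h
    refine ⟨s, (hCU s hs).1, (hCU s hs).2.1, (hCU s hs).2.2, hsimp.subset ?_⟩
    rintro w ⟨hwW, hsw⟩
    refine ⟨?_, hsw⟩
    by_cases hwC : w ∈ C
    · exact Or.inl hwC
    · exact Or.inr ⟨hwW, hwC, s, hs, hsw.symm⟩
  -- If some `t ∈ S` misses a vertex of `C ∪ S`, induction gives a simplicial non-neighbour of `t`,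
  -- not in the clique `S`. Otherwise `S` is joined to everything and a simplicial vertex of `C`
  -- suffices.
  by_cases hcase : ∃ t ∈ S, ∃ t' ∈ C ∪ S, t' ≠ t ∧ ¬H.Adj t t'
  · obtain ⟨t, ht, t', ht', hne, hnadj⟩ := hcase
    have hcoe : ((W.filter (· ∈ C ∪ S) : Finset V) : Set V) = C ∪ S := by
      ext x
      simp only [Finset.coe_filter, Set.mem_ofPred_eq]
      refine ⟨And.right, fun h => ⟨?_, h⟩⟩
      rcases h with h | h
      exacts [(hCU x h).1, h.1]
    have hmem : ∀ x, x ∈ W.filter (· ∈ C ∪ S) ↔ x ∈ C ∪ S := fun x => by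
      rw [← Finset.mem_coe, hcoe]
    obtain ⟨s, hs, hst, hnst, hsimp⟩ := ih (W.filter (· ∈ C ∪ S))
      (Finset.filter_ssubset.mpr ⟨v, hv, by
        rintro (h | h)
        · exact (hCU v h).2.1 rfl
        · exact (hSv v h).ne rfl⟩)
      (hch.mono (Finset.coe_subset.mpr (Finset.filter_subset _ _))) t
      ((hmem t).mpr (Or.inr ht)) ⟨t', (hmem t').mpr ht', hne, hnadj⟩
    rw [hcoe] at hsimp
    refine ⟨s, ?_, hsimp⟩
    rcases (hmem s).mp hs with h | h
    · exact h
    · exact (hnst (hSclique t ht s h hst.symm)).elim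
  · push Not at hcase
    have hcoe : ((W.filter (· ∈ C) : Finset V) : Set V) = C := by
      ext x
      simp only [Finset.coe_filter, Set.mem_ofPred_eq]
      exact ⟨And.right, fun h => ⟨(hCU x h).1, h⟩⟩
    have hmem : ∀ x, x ∈ W.filter (· ∈ C) ↔ x ∈ C := fun x => by
      rw [← Finset.mem_coe, hcoe]
    obtain ⟨s, hs, hsimp⟩ : ∃ s ∈ C, H.SimplicialIn s C := by
      by_cases hcl : ∃ x ∈ C, ∃ y ∈ C, y ≠ x ∧ ¬H.Adj x y
      · obtain ⟨x, hx, y, hy, hne, hnadj⟩ := hcl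
        obtain ⟨s, hs, -, -, hsimp⟩ := ih (W.filter (· ∈ C))
          (Finset.filter_ssubset.mpr ⟨v, hv, fun h => (hCU v h).2.1 rfl⟩)
          (hch.mono (Finset.coe_subset.mpr (Finset.filter_subset _ _))) x
          ((hmem x).mpr hx) ⟨y, (hmem y).mpr hy, hne, hnadj⟩
        rw [hcoe] at hsimp
        exact ⟨s, (hmem s).mp hs, hsimp⟩
      · push Not at hcl
        exact ⟨u, huC, fun x hx y hy hxy => hcl x hx.1 y hy.1 hxy.symm⟩
    refine ⟨s, hs, ?_⟩
    rintro x ⟨hx, hsx⟩ y ⟨hy, hsy⟩ hxy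
    rcases hx with hx | hx
    · rcases hy with hy | hy
      · exact hsimp ⟨hx, hsx⟩ ⟨hy, hsy⟩ hxy
      · exact (hcase y hy x (Or.inl hx) hxy).symm
    · exact hcase x hx y hy hxy.symm

theorem exists_simplicial {W : Finset V} (hW : W.Nonempty) (hch : H.ChordalOn W) :
    ∃ s ∈ W, H.SimplicialIn s W := by
  by_cases h : ∃ v ∈ W, ∃ u ∈ W, u ≠ v ∧ ¬H.Adj v u
  · obtain ⟨v, hv, hu⟩ := h
    obtain ⟨s, hs, -, -, hsimp⟩ := exists_simplicial_not_adj W hch v hv hu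
    exact ⟨s, hs, hsimp⟩
  · push Not at h
    obtain ⟨s, hs⟩ := hW
    exact ⟨s, hs, fun x hx y hy hxy => h x hx.1 y hy.1 hxy.symm⟩

end Dirac

/-! ### Regularity of clique complexes -/

section CliqueComplex

variable {V : Type*}

/-- The clique complex of `H` on the vertices of `W`. -/
def cliqueFaces (H : SimpleGraph V) (W : Finset V) : LowerSet (Finset V) where
  carrier := {T | T ⊆ W ∧ H.IsClique (T : Set V)}
  lower' _ _ h hT := ⟨h.trans hT.1, hT.2.subset (Finset.coe_subset.mpr h)⟩

theorem mem_cliqueFaces {H : SimpleGraph V} {W T : Finset V} :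
    T ∈ cliqueFaces H W ↔ T ⊆ W ∧ H.IsClique (T : Set V) := Iff.rfl

variable [LinearOrder V]

theorem faceDeletion_cliqueFaces (H : SimpleGraph V) (W : Finset V) (x : V) :
    faceDeletion (cliqueFaces H W) x = cliqueFaces H (W.erase x) := by
  ext T
  simp only [SetLike.mem_coe, mem_faceDeletion, mem_cliqueFaces, Finset.subset_erase]
  tauto

theorem faceDeletion_faceStar_cliqueFaces (H : SimpleGraph V) [DecidableRel H.Adj] {W : Finset V}
    {x : V} (hx : x ∈ W) :
    faceDeletion (faceStar (cliqueFaces H W) x) x = cliqueFaces H (W.filter (H.Adj x)) := by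
  ext T
  simp only [SetLike.mem_coe, mem_faceDeletion, mem_faceStar, mem_cliqueFaces,
    Finset.insert_subset_iff, Finset.coe_insert, SimpleGraph.isClique_insert]
  constructor
  · rintro ⟨⟨⟨-, hTW⟩, hcl, hadj⟩, hxT⟩
    refine ⟨fun t ht => Finset.mem_filter.mpr ⟨hTW ht, hadj t ht ?_⟩, hcl⟩
    rintro rfl
    exact hxT ht
  · rintro ⟨hT, hcl⟩
    have hadj : ∀ t ∈ T, H.Adj x t := fun t ht => (Finset.mem_filter.mp (hT ht)).2
    exact ⟨⟨⟨hx, hT.trans (Finset.filter_subset _ _)⟩, hcl, fun t ht _ => hadj t ht⟩,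
      fun h => (hadj x h).ne rfl⟩

variable [Fintype V] {K : Type*} [Field K]

/-- The star is a cone with apex `x` over the link, so it inherits the regularity bound of the link.
-/
theorem QuotRegular.of_link_of_deletion {D : LowerSet (Finset V)} {x : V} {r : ℕ}
    (hlink : QuotRegular (faceIdeal K (faceDeletion (faceStar D x) x)) r)
    (hdel : QuotRegular (faceIdeal K (faceDeletion D x)) (r + 1)) :
    QuotRegular (faceIdeal K D) (r + 1) := by
  refine .of_star_of_deletion (.of_cone ?_ hlink) hdel
  ext T
  simp [mem_faceStar]

/-- Chordal graphs: the easy half of Fröberg's theorem. -/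
theorem quotRegular_of_chordalOn {H : SimpleGraph V} (W : Finset V) : H.ChordalOn W →
    QuotRegular (faceIdeal K (cliqueFaces H W)) 1 := by
  classical
  induction W using Finset.strongInduction with
  | H W ih =>
  intro hch
  rcases W.eq_empty_or_nonempty with rfl | hne
  · exact (QuotRegular.of_subset_empty (D := cliqueFaces H ∅)
      fun T hT => Finset.subset_empty.mp hT.1).mono zero_le_one
  obtain ⟨s, hs, hsimp⟩ := exists_simplicial hne hch
  refine .of_link_of_deletion (x := s) ?_ ?_
  -- The neighbours of a simplicial vertex form a clique, so the link is a full simplex.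
  · rw [faceDeletion_faceStar_cliqueFaces H hs]
    convert QuotRegular.faceIdeal_Iic (K := K) (W.filter (H.Adj s)) using 2
    ext T
    simp only [SetLike.mem_coe, mem_cliqueFaces, LowerSet.mem_Iic_iff]
    refine and_iff_left_of_imp fun hT => hsimp.subset fun t ht => ?_
    exact Finset.mem_filter.mp (hT ht)
  · rw [faceDeletion_cliqueFaces]
    exact ih _ (Finset.erase_ssubset hs)
      (hch.mono (Finset.coe_subset.mpr (Finset.erase_subset _ _)))

/-- Graphs all of whose vertex links are chordal. -/
theorem quotRegular_of_chordalOn_neighborSet {H : SimpleGraph V}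
    (hch : ∀ x, H.ChordalOn (H.neighborSet x)) (W : Finset V) :
    QuotRegular (faceIdeal K (cliqueFaces H W)) 2 := by
  classical
  induction W using Finset.strongInduction with
  | H W ih =>
  rcases W.eq_empty_or_nonempty with rfl | ⟨s, hs⟩
  · exact (QuotRegular.of_subset_empty (D := cliqueFaces H ∅)
      fun T hT => Finset.subset_empty.mp hT.1).mono
      zero_le_two
  refine .of_link_of_deletion (x := s) ?_ ?_
  · rw [faceDeletion_faceStar_cliqueFaces H hs]
    exact quotRegular_of_chordalOn _ ((hch s).mono fun t ht => (Finset.mem_filter.mp ht).2)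
  · rw [faceDeletion_cliqueFaces]
    exact ih _ (Finset.erase_ssubset hs)

end CliqueComplex

/-! ### Neighbourhoods in cactus decompositions -/

section Cactus

variable {V W : Type*} {T : SimpleGraph W}

/-- In a cactus, three pairwise incident edges on a common cycle are all the edges of that
cycle. -/
theorem IsCactusGraph.mem_of_mem_cycle (hT : IsCactusGraph T) {w : W} {p : T.Walk w w}
    (hp : p.IsCycle) {e₁ e₂ e₃ : Sym2 W} (h₁ : e₁ ∈ p.edges) (h₂ : e₂ ∈ p.edges)
    (h₃ : e₃ ∈ p.edges) (h₁₂ : e₁ ≠ e₂) (h₂₃ : e₂ ≠ e₃) (h₁₃ : e₁ ≠ e₃)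
    (i₁₂ : ∃ w, w ∈ e₁ ∧ w ∈ e₂) (i₂₃ : ∃ w, w ∈ e₂ ∧ w ∈ e₃) (i₁₃ : ∃ w, w ∈ e₁ ∧ w ∈ e₃)
    {f : Sym2 W} (hf : f ∈ p.edges) : f = e₁ ∨ f = e₂ ∨ f = e₃ := by
  obtain ⟨b, hb₁, hb₂⟩ := i₁₂
  obtain ⟨a, rfl⟩ := hb₁
  obtain ⟨c, rfl⟩ := hb₂
  have hac : a ≠ c := by rintro rfl; exact h₁₂ rfl
  have hba : T.Adj b a := p.adj_of_mem_edges h₁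
  have hbc : T.Adj b c := p.adj_of_mem_edges h₂
  -- A vertex of a cycle has only two neighbours along it, so the third edge avoids `b` and must
  -- join `a` to `c`.
  have hb₃ : b ∉ e₃ := by
    rintro ⟨d, rfl⟩
    have hda : d ≠ a := by rintro rfl; exact h₁₃ rfl
    have hdc : d ≠ c := by rintro rfl; exact h₂₃ rfl
    have hcard := hp.ncard_neighborSet_toSubgraph_eq_two (p.fst_mem_support_of_mem_edges h₁)
    have hsub : ({a, c, d} : Set W) ⊆ p.toSubgraph.neighborSet b := by
      rintro x (rfl | rfl | rfl)
      exacts [p.mem_edges_toSubgraph.mpr h₁, p.mem_edges_toSubgraph.mpr h₂,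
        p.mem_edges_toSubgraph.mpr h₃]
    have hfin : (p.toSubgraph.neighborSet b).Finite := Set.finite_of_ncard_ne_zero (by omega)
    have h3 := Set.ncard_le_ncard hsub hfin
    rw [hcard, Set.ncard_eq_three.mpr ⟨a, c, d, hac, hda.symm, hdc.symm, rfl⟩] at h3
    omega
  have ha₃ : a ∈ e₃ := by
    obtain ⟨x, hx, hx'⟩ := i₁₃
    rcases Sym2.mem_iff.mp hx with rfl | rfl
    exacts [(hb₃ hx').elim, hx']
  have hc₃ : c ∈ e₃ := by
    obtain ⟨x, hx, hx'⟩ := i₂₃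
    rcases Sym2.mem_iff.mp hx with rfl | rfl
    exacts [(hb₃ hx').elim, hx']
  obtain rfl : e₃ = s(a, c) := (Sym2.mem_and_mem_iff hac).mp ⟨ha₃, hc₃⟩
  have hca : T.Adj c a := (p.adj_of_mem_edges h₃).symm
  let q : T.Walk a a := .cons hba.symm (.cons hbc (.cons hca .nil))
  have hq : q.IsCycle := by
    simp [q, SimpleGraph.Walk.isCycle_def, SimpleGraph.Walk.isTrail_def, hba.ne, hba.ne', hbc.ne,
      hca.ne, hca.ne']
  -- The triangle `q` shares an edge with `p`, so the cactus property identifies their edge sets.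
  have := (hT a w q p hq hp s(b, a) (by simp [q]) h₁ f).mpr hf
  simp only [q, SimpleGraph.Walk.edges_cons, SimpleGraph.Walk.edges_nil, List.mem_cons,
    List.not_mem_nil, or_false] at this
  rcases this with rfl | rfl | rfl
  · exact Or.inl Sym2.eq_swap
  · exact Or.inr (Or.inl rfl)
  · exact Or.inr (Or.inr Sym2.eq_swap)

namespace IsChordalCactusDecomposition

variable {H : SimpleGraph V} {S : T.edgeSet → Set V} (h : IsChordalCactusDecomposition H T S)
include h

theorem piece_unique {e f : T.edgeSet} {x y : V} (hxy : x ≠ y) (hxe : x ∈ S e) (hye : y ∈ S e)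
    (hxf : x ∈ S f) (hyf : y ∈ S f) : e = f := by
  by_contra hef
  exact hxy (h.inter_subsingleton e f hef ⟨hxe, hxf⟩ ⟨hye, hyf⟩)

/-- The pieces of the edges of a triangle which does not lie in one piece. -/
theorem exists_cycle_of_triangle {x y z : V} {e₁ e₂ e₃ : T.edgeSet} (hxy : x ≠ y) (hxz : x ≠ z)
    (hyz : y ≠ z) (hx₁ : x ∈ S e₁) (hy₁ : y ∈ S e₁) (hx₂ : x ∈ S e₂) (hz₂ : z ∈ S e₂)
    (hy₃ : y ∈ S e₃) (hz₃ : z ∈ S e₃) (h₁₂ : e₁ ≠ e₂) :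
    e₁ ≠ e₃ ∧ e₂ ≠ e₃ ∧ ∃ (w : W) (p : T.Walk w w), p.IsCycle ∧ e₁.1 ∈ p.edges ∧
      ∀ f : T.edgeSet, f.1 ∈ p.edges ↔ f = e₁ ∨ f = e₂ ∨ f = e₃ := by
  have h₁₃ : e₁ ≠ e₃ := by
    rintro rfl
    exact h₁₂ (h.piece_unique hxz hx₁ hz₃ hx₂ hz₂)
  have h₂₃ : e₂ ≠ e₃ := by
    rintro rfl
    exact h₁₂ (h.piece_unique hxy hx₁ hy₁ hx₂ hy₃)
  -- The order `x, z, y` puts each vertex into the intersection of cyclically consecutive pieces.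
  obtain ⟨w, p, hp, hmem⟩ := h.gluing_cycle 0 ![e₁, e₂, e₃] ![x, z, y]
    (by
      intro i j hij
      fin_cases i <;> fin_cases j <;> simp_all)
    (by
      intro i j hij
      fin_cases i <;> fin_cases j <;> simp_all)
    (by
      intro i
      fin_cases i
      exacts [⟨hx₁, hx₂⟩, ⟨hz₂, hz₃⟩, ⟨hy₃, hy₁⟩])
  have m₁ : e₁.1 ∈ p.edges := hmem 0
  have m₂ : e₂.1 ∈ p.edges := hmem 1
  have m₃ : e₃.1 ∈ p.edges := hmem 2
  refine ⟨h₁₃, h₂₃, w, p, hp, m₁, fun f => ⟨fun hf => ?_, ?_⟩⟩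
  · have := h.cactus.mem_of_mem_cycle hp m₁ m₂ m₃ (Subtype.coe_ne_coe.mpr h₁₂)
      (Subtype.coe_ne_coe.mpr h₂₃) (Subtype.coe_ne_coe.mpr h₁₃)
      (h.common_endpoint _ _ h₁₂ ⟨x, hx₁, hx₂⟩) (h.common_endpoint _ _ h₂₃ ⟨z, hz₂, hz₃⟩)
      (h.common_endpoint _ _ h₁₃ ⟨y, hy₁, hy₃⟩) hf
    simpa only [Subtype.ext_iff] using this
  · rintro (rfl | rfl | rfl)
    exacts [m₁, m₂, m₃]

/-- Two triangles with a common vertex `x`, neither of them in one piece, and with a common piece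
at `x` coincide. -/
theorem triangle_unique {x y z y' z' : V} {e f f' : T.edgeSet} (hyz : H.Adj y z)
    (hyz' : H.Adj y' z') (hxy : x ≠ y) (hxz : x ≠ z) (hxy' : x ≠ y') (hxz' : x ≠ z')
    (hxe : x ∈ S e) (hye : y ∈ S e) (hye' : y' ∈ S e) (hxf : x ∈ S f) (hzf : z ∈ S f)
    (hxf' : x ∈ S f') (hzf' : z' ∈ S f') (hef : e ≠ f) (hef' : e ≠ f') : y = y' ∧ z = z' := by
  obtain ⟨g, hyg, hzg⟩ := h.cover_edges _ _ hyz
  obtain ⟨g', hyg', hzg'⟩ := h.cover_edges _ _ hyz'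
  obtain ⟨heg, hfg, w, p, hp, hep, hpe⟩ :=
    h.exists_cycle_of_triangle hxy hxz hyz.ne hxe hye hxf hzf hyg hzg hef
  obtain ⟨heg', hfg', w', p', hp', hep', hpe'⟩ :=
    h.exists_cycle_of_triangle hxy' hxz' hyz'.ne hxe hye' hxf' hzf' hyg' hzg' hef'
  -- Both skeleton cycles contain `e`, hence coincide.
  have hmem : ∀ k : T.edgeSet, (k = e ∨ k = f' ∨ k = g') → k = e ∨ k = f ∨ k = g := fun k hk =>
    (hpe k).mp ((h.cactus _ _ p p' hp hp' e hep hep' k).mpr ((hpe' k).mpr hk))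
  have hxg : x ∉ S g := fun hxg => heg (h.piece_unique hxy hxe hye hxg hyg)
  have hff : f' = f := by
    rcases hmem f' (by simp) with rfl | rfl | rfl
    exacts [(hef' rfl).elim, rfl, (hxg hxf').elim]
  subst hff
  have hgg : g' = g := by
    rcases hmem g' (by simp) with rfl | rfl | rfl
    exacts [(heg' rfl).elim, (hfg' rfl).elim, rfl]
  subst hgg
  exact ⟨h.inter_subsingleton _ _ heg ⟨hye, hyg⟩ ⟨hye', hyg'⟩,
    h.inter_subsingleton _ _ hfg ⟨hzf, hzg⟩ ⟨hzf', hzg'⟩⟩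

open Fin.CommRing in
/-- An induced cycle in the neighbourhood of `x` lies in one piece together with `x`. -/
theorem exists_piece_of_cycle {n : ℕ} (f : SimpleGraph.cycleGraph (n + 4) ↪g H) {x : V}
    (hf : ∀ i, H.Adj x (f i)) : ∃ e, x ∈ S e ∧ ∀ i, f i ∈ S e := by
  choose c hxc hfc using fun i => h.cover_edges _ _ (hf i)
  have hadj : ∀ i, H.Adj (f i) (f (i + 1)) := fun i =>
    f.map_adj_iff.mpr (SimpleGraph.cycleGraph_adj.mpr (Or.inr (by ring)))
  have hsucc : ∀ i, c i = c (i + 1) := by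
    intro i
    by_contra hne
    -- After a change of piece from `i` to `i + 1`, a next change at `j` would give a second
    -- triangle using the same piece, forcing `i + 1 = j` and `i = j + 1`, hence `2 = 0` modulo `n +
    -- 4`.
    have hconst : ∀ k : ℕ, c (i + 1 + (k : Fin (n + 4))) = c (i + 1) := by
      intro k
      induction k with
      | zero => simp
      | succ k ih =>
        by_contra hk
        set j : Fin (n + 4) := i + 1 + (k : Fin (n + 4)) with hj
        have hjs : i + 1 + ((k + 1 : ℕ) : Fin (n + 4)) = j + 1 := by push_cast; ring
        rw [hjs] at hk
        have huniq := h.triangle_unique (hadj i).symm (hadj j) (hf _).ne (hf _).ne (hf _).ne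
          (hf _).ne (hxc (i + 1)) (hfc (i + 1)) (ih ▸ hfc j) (hxc i) (hfc i) (hxc (j + 1))
          (hfc (j + 1)) (Ne.symm hne) (Ne.symm hk)
        have e1 : i + 1 = j := f.injective huniq.1
        have e2 : i = j + 1 := f.injective huniq.2
        rw [← e1, add_assoc, left_eq_add] at e2
        have := congrArg Fin.val e2
        simp [Fin.val_add, Nat.mod_eq_of_lt] at this
    refine hne ?_
    -- Going on for `n + 3` steps returns to `i`, contradicting the change there.
    have := hconst (n + 3)
    rw [← this]
    congr 1
    have : ((n + 3 : ℕ) : Fin (n + 4)) + 1 = 0 := by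
      have := Fin.natCast_self (n + 4)
      push_cast at this ⊢
      rw [← this]; ring
    rw [add_assoc, add_comm 1, this, add_zero]
  have hall : ∀ k : ℕ, c (k : Fin (n + 4)) = c 0 := by
    intro k
    induction k with
    | zero => simp
    | succ k ih => rw [Nat.cast_succ, ← hsucc, ih]
  refine ⟨c 0, hxc 0, fun i => ?_⟩
  have := hall i.val
  rw [Fin.cast_val_eq_self] at this
  exact this ▸ hfc i

/-- In a piece that is a cycle, `x` has only two neighbours, too few for the rim; in a chordal piece
the rim itself is forbidden. -/
theorem chordalOn_neighborSet (x : V) : H.ChordalOn (H.neighborSet x) := by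
  intro n hn f hf
  obtain ⟨n, rfl⟩ : ∃ m, n = m + 4 := ⟨n - 4, by omega⟩
  obtain ⟨e, hxe, hfe⟩ := h.exists_piece_of_cycle f hf
  rcases h.cycle_or_chordal e with ⟨m, hm, ⟨φ⟩⟩ | hch
  · obtain ⟨m, rfl⟩ : ∃ k, m = k + 3 := ⟨m - 3, by omega⟩
    have hinj : Function.Injective fun i : Fin (n + 4) =>
        (⟨φ.symm ⟨f i, hfe i⟩, by
          rw [SimpleGraph.mem_neighborFinset, ← φ.map_adj_iff, φ.apply_symm_apply,
            φ.apply_symm_apply]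
          exact hf i⟩ :
          (SimpleGraph.cycleGraph (m + 3)).neighborFinset (φ.symm ⟨x, hxe⟩)) := by
      intro i j hij
      have h1 := φ.symm.injective (congrArg Subtype.val hij)
      exact f.injective (congrArg Subtype.val h1)
    have := Fintype.card_le_of_injective _ hinj
    rw [Fintype.card_fin, Fintype.card_coe, SimpleGraph.card_neighborFinset_eq_degree,
      SimpleGraph.cycleGraph_degree_three_le] at this
    omega
  · exact hch (n + 4) hn ⟨⟨⟨fun i => ⟨f i, hfe i⟩, fun i j hij =>
      f.injective (congrArg Subtype.val hij)⟩, f.map_adj_iff⟩⟩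

end IsChordalCactusDecomposition

end Cactus

/-! ### The edge ideal and the main theorem -/

/-- The edge ideal of `G` is the Stanley–Reisner ideal of the clique complex of its
complement. -/
theorem connectedIdeal_one_eq_faceIdeal (K : Type*) [Field K] {V : Type*} [Fintype V]
    (G : SimpleGraph V) : connectedIdeal K G 1 = faceIdeal K (cliqueFaces Gᶜ Finset.univ) := by
  classical
  apply le_antisymm
  · refine Ideal.span_le.mpr ?_
    rintro _ ⟨S, hS, hconn, rfl⟩
    obtain ⟨u, v, huv, rfl⟩ := Finset.card_eq_two.mp hS
    have hadj : G.Adj u v := by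
      have : Nontrivial (({u, v} : Finset V) : Set V) :=
        ⟨⟨u, by simp⟩, ⟨v, by simp⟩, by simpa using huv⟩
      obtain ⟨w, hw⟩ := hconn.preconnected.exists_adj_of_nontrivial ⟨u, by simp⟩
      obtain ⟨w, hw'⟩ := w
      have hw2 : G.Adj u w := hw
      simp only [Finset.coe_insert, Finset.coe_singleton, Set.mem_insert_iff,
        Set.mem_singleton_iff] at hw'
      rcases hw' with rfl | rfl
      exacts [(hw2.ne rfl).elim, hw2]
    rw [Finset.prod_pair huv]
    intro m hm hmc
    rw [X, X, monomial_mul, one_mul] at hm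
    obtain rfl := Finset.mem_singleton.mp (support_monomial_subset hm)
    refine (hmc.2 (x := u) (y := v) ?_ ?_ huv).2 hadj
    · simp
    · simp
  · intro p hp
    rw [p.as_sum]
    refine Ideal.sum_mem _ fun m hm => ?_
    -- A support that is not a clique of the complement contains an edge of `G`, whose generator
    -- divides the monomial.
    have hnc : ¬Gᶜ.IsClique (m.support : Set V) := fun hcl =>
      hp m hm ⟨Finset.subset_univ _, hcl⟩
    simp only [SimpleGraph.IsClique, Set.Pairwise, not_forall] at hnc
    obtain ⟨u, hu, v, hv, huv, hnadj⟩ := hnc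
    have hadj : G.Adj u v := by
      by_contra hG
      exact hnadj ⟨huv, hG⟩
    have hmem : (X u * X v : MvPolynomial V K) ∈ connectedIdeal K G 1 := by
      refine Ideal.subset_span ⟨{u, v}, Finset.card_pair huv, ?_, (Finset.prod_pair huv).symm⟩
      rw [Finset.coe_pair]
      exact SimpleGraph.induce_pair_connected_of_adj hadj
    have hle : Finsupp.single u 1 + Finsupp.single v 1 ≤ m := by
      intro w
      have hu' : m u ≠ 0 := Finsupp.mem_support_iff.mp hu
      have hv' : m v ≠ 0 := Finsupp.mem_support_iff.mp hv
      by_cases hwu : u = w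
      · subst hwu
        simp [huv.symm]; omega
      · by_cases hwv : v = w
        · subst hwv
          simp [huv]; omega
        · simp [hwu, hwv]
    obtain ⟨k, rfl⟩ := exists_add_of_le hle
    have : monomial (Finsupp.single u 1 + Finsupp.single v 1 + k)
        (coeff (Finsupp.single u 1 + Finsupp.single v 1 + k) p) =
        monomial k (coeff (Finsupp.single u 1 + Finsupp.single v 1 + k) p) * (X u * X v) := by
      rw [X, X, monomial_mul, monomial_mul, one_mul, mul_one, add_comm k]
    rw [this]
    exact Ideal.mul_mem_left _ _ hmem

theorem mainTheorem3 {K : Type*} [Field K] {V : Type*} [Finite V] (G : SimpleGraph V)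
    (hG : IsCoChordalCactus G) :
    castelnuovoMumfordRegularity (connectedIdeal K G 1) ≤ 3 := by
  obtain ⟨m, T, S, h⟩ := hG
  have := Fintype.ofFinite V
  -- An arbitrary order on the vertices, needed only for the Koszul signs.
  let _ : LinearOrder V := LinearOrder.lift' (Fintype.equivFin V) (Fintype.equivFin V).injective
  rw [connectedIdeal_one_eq_faceIdeal]
  exact castelnuovoMumfordRegularity_le (r := 2)
    (fun _ hp d => homogeneousComponent_mem_faceIdeal hp d)
    (quotRegular_of_chordalOn_neighborSet h.chordalOn_neighborSet _)
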